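/- Let $\Gamma$ be a graph with graph distance $d_\Gamma$, let $D\ge 1$ be an integer, $C_\Gamma\ge 1$, and let $\iota:\Gamma\to\mathbb R^D$ be an injective map on the vertices with $$C_\Gamma^{-1}|\iota(i)-\iota(j)|\le d_\Gamma(i,j)\le C_\Gamma|\iota(i)-\iota(j)|\qquad\text{for all } i,j\in\Gamma .$$ For finite $X\subset\Gamma$ put $\mathcal H_X=\bigotimes_{i\in X}\mathbb C^d$, let $\mathcal A_X$ be the algebra of linear operators on $\mathcal H_X$, and regard $\mathcal A_X\subset\mathcal A_Y$ for $X\subset Y$ through $A\mapsto A\otimes \mathrm{Id}_{Y\setminus X}$. For a Hermitian operator $A$ write $\mathrm{gap}(A)=\inf(\mathrm{spec}\,A\setminus\{0\})$, with $\inf\emptyset=+\infty$. For every finite $X\subset\Gamma$ let $\Phi(X)\in\mathcal A_X$ be Hermitian with $\Phi(X)\ge 0$, and suppose: 1. (finite range) there is $R>0$ with $\Phi(X)=0$ whenever the diameter of $X$ with respect to $d_\Gamma$ exceeds $R$; 2. (uniform bounds) $\sup_X\|\Phi(X)\|<\infty$ and $\inf_{X:\,\Phi(X)\ne 0}\mathrm{gap}(\Phi(X))>0$;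 3. (frustration-freeness) for every finite $\Lambda\subset\Gamma$ the Hamiltonian $H_\Lambda=\sum_{X\subset\Lambda}\Phi(X)$ on $\mathcal H_\Lambda$ satisfies $\ker H_\Lambda\neq\{0\}$. For $k\in\mathbb N$ let $l_k=(3/2)^{k/D}$ and $R(k)=[0,l_{k+1}]\times\cdots\times[0,l_{k+D}]\subset\mathbb R^D$. Let $\mathcal F_k$ be the collection of all sets $\Lambda\subset\Gamma$ such that $\iota(\Lambda)$ is contained in $R(k)$ up to translations and permutations of the coordinates (such sets are finite), and put $$\mathrm{gap}(\mathcal F_k)=\inf_{\Lambda\in\mathcal F_k}\mathrm{gap}(H_\Lambda).$$ If $\inf_{k\ge 1}\mathrm{gap}(\mathcal F_k)=0$, then for every $\epsilon>0$ $$\mathrm{gap}(\mathcal F_k)=o\!\left(\frac{k^{4+\epsilon}}{l_k^2}\right)\qquad\text{as } k\to\infty;$$ in particular $\mathrm{gap}(\mathcal F_k)$ is finite for all sufficiently large $k$. -/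

import Mathlib

open Filter Asymptotics
open scoped ComplexOrder

namespace FFGap

/-- The basis configurations on a finite region `X`, for a `d`-dimensional local Hilbert space:
the vectors `⨂_{i ∈ X} e_{σ i}`, `σ : X → Fin d`, are the product basis of `⨂_{i ∈ X} ℂ^d`. -/
abbrev Conf {V : Type*} (d : ℕ) (X : Finset V) : Type _ := X → Fin d

/-- The local algebra of a finite region `X`: all linear operators on `⨂_{i ∈ X} ℂ^d`, written as
complex matrices in the product basis. -/
abbrev LocalAlg {V : Type*} (d : ℕ) (X : Finset V) : Type _ := Matrix (Conf d X) (Conf d X) ℂ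

/-- Restriction of a configuration on `Y` to a subregion `X ⊆ Y`. -/
def restrictConf {V : Type*} {d : ℕ} {X Y : Finset V} (h : X ⊆ Y) (σ : Conf d Y) : Conf d X :=
  fun i => σ ⟨i.1, h i.2⟩

open Classical in
/-- The natural inclusion of local algebras for `X ⊆ Y`, `A ↦ A ⊗ Id_{Y \ X}`. -/
noncomputable def incl {V : Type*} {d : ℕ} {X Y : Finset V} (h : X ⊆ Y) (A : LocalAlg d X) :
    LocalAlg d Y :=
  Matrix.of fun σ τ =>
    if ∀ i : Y, i.1 ∉ X → σ i = τ i then A (restrictConf h σ) (restrictConf h τ) else 0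

/-- The gap `inf (spec A \ {0})` of a Hermitian matrix, with values in the extended reals: the
infimum over the empty set (when `A = 0`) is `⊤`. -/
noncomputable def gap {n : Type*} [Fintype n] [DecidableEq n] (A : Matrix n n ℂ) : EReal :=
  ⨅ E ∈ spectrum ℝ A \ {0}, (E : EReal)

/-- An interaction assigns an element of the local algebra to every finite region. -/
abbrev Interaction (V : Type*) (d : ℕ) : Type _ := ∀ X : Finset V, LocalAlg d X

/-- Finite interaction range: `Φ X = 0` whenever the diameter of `X` in the graph distance
exceeds `R`. -/
def HasRange {V : Type*} {d : ℕ} (G : SimpleGraph V) (Φ : Interaction V d) (R : ℝ) : Prop :=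
  ∀ X : Finset V, (∃ i ∈ X, ∃ j ∈ X, R < (G.dist i j : ℝ)) → Φ X = 0

/-- `Φ_max`, the supremum of the operator norms of the interaction terms. -/
noncomputable def phiMax {V : Type*} [DecidableEq V] {d : ℕ} (Φ : Interaction V d) : ENNReal :=
  ⨆ X : Finset V, ‖Matrix.toEuclideanCLM (n := Conf d X) (𝕜 := ℂ) (Φ X)‖ₑ

/-- `Φ_min`, the infimum of the gaps of the nonzero interaction terms. -/
noncomputable def phiMin {V : Type*} [DecidableEq V] {d : ℕ} (Φ : Interaction V d) : EReal :=
  ⨅ (X : Finset V) (_ : Φ X ≠ 0), gap (Φ X)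

/-- The Hamiltonian `H_Λ = ∑_{X ⊆ Λ} Φ(X)`. -/
noncomputable def hamiltonian {V : Type*} {d : ℕ} (Φ : Interaction V d) (Λ : Finset V) :
    LocalAlg d Λ :=
  ∑ X ∈ Λ.powerset.attach, incl (Finset.mem_powerset.mp X.2) (Φ X.1)

/-- Frustration-freeness: every finite-volume Hamiltonian has a nontrivial kernel. -/
def FrustrationFree {V : Type*} [DecidableEq V] {d : ℕ} (Φ : Interaction V d) : Prop :=
  ∀ Λ : Finset V, LinearMap.ker (Matrix.mulVecLin (hamiltonian Φ Λ)) ≠ ⊥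

/-- A bi-Lipschitz embedding of the vertices, with the graph distance, into Euclidean space. Since
`ι` is injective and `SimpleGraph.dist` vanishes between different components, the lower bound
forces any two vertices to be joined by a path, so that `G.dist` is the true graph distance. -/
def IsBiLipschitzEmbedding {V : Type*} {D : ℕ} (G : SimpleGraph V) (C : ℝ)
    (ι : V → EuclideanSpace ℝ (Fin D)) : Prop :=
  Function.Injective ι ∧
    ∀ i j : V, C⁻¹ * ‖ι i - ι j‖ ≤ (G.dist i j : ℝ) ∧ (G.dist i j : ℝ) ≤ C * ‖ι i - ι j‖

/-- The length scale `l_k = (3/2)^(k/D)`. -/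
noncomputable def len (D k : ℕ) : ℝ := (3 / 2 : ℝ) ^ ((k : ℝ) / (D : ℝ))

/-- The rectangle `R(k) = [0, l_{k+1}] × ⋯ × [0, l_{k+D}]`; the coordinates `j : Fin D` are counted
from `0`. -/
def rect (D k : ℕ) : Set (EuclideanSpace ℝ (Fin D)) :=
  {x | ∀ j : Fin D, x j ∈ Set.Icc 0 (len D (k + (j.1 + 1)))}

/-- The family `F_k` of all (finite) sets of vertices whose image is contained in `R(k)` up to a
translation and a permutation of the coordinates. -/
def family {V : Type*} {D : ℕ} (ι : V → EuclideanSpace ℝ (Fin D)) (k : ℕ) : Set (Finset V) :=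
  {Λ | ∃ (a : EuclideanSpace ℝ (Fin D)) (π : Equiv.Perm (Fin D)),
    ∀ i ∈ Λ, WithLp.toLp 2 (fun j => (ι i - a) (π j)) ∈ rect D k}

/-- `gap(F_k)`, the infimum of the gaps of `H_Λ` over `Λ ∈ F_k`. -/
noncomputable def gapFamily {V : Type*} [DecidableEq V] {d D : ℕ} (Φ : Interaction V d)
    (ι : V → EuclideanSpace ℝ (Fin D)) (k : ℕ) : EReal :=
  ⨅ Λ ∈ family ι k, gap (hamiltonian Φ Λ)

/-- The infinite-volume gap `gap(Γ) = inf_{k ≥ 1} gap(F_k)`. -/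
noncomputable def gapInfinite {V : Type*} [DecidableEq V] {d D : ℕ} (Φ : Interaction V d)
    (ι : V → EuclideanSpace ℝ (Fin D)) : EReal :=
  ⨅ (k : ℕ) (_ : 1 ≤ k), gapFamily Φ ι k

end FFGap

/-! Divide and conquer. With `M` a bound on the norms, write every term as `M • (b† b)` with `‖b‖ ≤
1`, so that ground vectors are the common zeros of the `b`. Boundedly many terms, say `g`, meet a
given one. By the detectability lemma, an ordered product of all `1 - b† b` contracts the complement
of the ground space of a region of gap `γ` (in units of `M`), multiplying squared norms by at most
`1 / (1 + γ / g²)`.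

Order the product in an even and an odd layer of strips across one coordinate, and let `K` be the
product times its adjoint. Cut the region into two parts that overlap in about `4 n` strips. If `x`
and `y` are ground vectors of the parts, then `⟨x, K ^ j y⟩ = ⟨x, y⟩` for `j ≤ n`, because each
power uses up four strips. Hence `⟨x, y⟩ = ⟨x, p(K) y⟩` for every `p` of degree at most `n` with
`p(1) = 1`; a rescaled Chebyshev polynomial gives almost orthogonality, up to `δ ~ g² / (n² γ)`, off
the ground space (`norm_inner_ground_le`). The square in `n²` is what produces the exponent 2 of
`l_k`.

Averaging over `s` cuts with disjoint overlaps bounds the gap `r` of the pieces by `(1 + 1/s)(γ +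
const / n²)` (`gap_le_of_cuts`). A set in `F_{k+1}` is cut along its longest side into sets in
`F_k`; with `s = (k+1)²` and `n ~ l_k / k²` the factors `1 + 1/s` have a convergent product and the
errors `k⁴ / l_k²` a geometrically decaying tail. As the gaps tend to 0, iterating to infinity
leaves `gap(F_k) = O(k⁴ / l_k²)`. -/

namespace FFGap

/-! ### Detectability lemma for products of `1 - b† b`. -/

section Detectability

variable {E : Type*} [NormedAddCommGroup E] [InnerProductSpace ℂ E] [CompleteSpace E]

/-- The operator `1 - b† b`. -/
noncomputable def defect (b : E →L[ℂ] E) : E →L[ℂ] E := 1 - star b * b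

theorem defect_apply (b : E →L[ℂ] E) (v : E) : defect b v = v - star b (b v) := by
  simp [defect]

theorem isSelfAdjoint_defect (b : E →L[ℂ] E) : IsSelfAdjoint (defect b) :=
  (IsSelfAdjoint.one _).sub (IsSelfAdjoint.star_mul_self b)

theorem defect_apply_of_apply_eq_zero {b : E →L[ℂ] E} {v : E} (h : b v = 0) : defect b v = v := by
  simp [defect_apply, h]

theorem inner_defect_apply (b : E →L[ℂ] E) (x y : E) :
    inner ℂ x (defect b y) = inner ℂ (defect b x) y := by
  conv_rhs => rw [← isSelfAdjoint_defect b]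
  rw [ContinuousLinearMap.star_eq_adjoint, ContinuousLinearMap.adjoint_inner_left]

theorem re_inner_star_mul_self (b : E →L[ℂ] E) (v : E) :
    (inner ℂ v (star b (b v))).re = ‖b v‖ ^ 2 := by
  rw [ContinuousLinearMap.star_eq_adjoint, ContinuousLinearMap.adjoint_inner_right]
  exact inner_self_eq_norm_sq (𝕜 := ℂ) (b v)

omit [CompleteSpace E] in
theorem norm_apply_le_of_norm_le_one {b : E →L[ℂ] E} (hb : ‖b‖ ≤ 1) (v : E) : ‖b v‖ ≤ ‖v‖ := by
  simpa using b.le_of_opNorm_le hb v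

theorem norm_star_le_one {b : E →L[ℂ] E} (hb : ‖b‖ ≤ 1) : ‖star b‖ ≤ 1 :=
  (LinearIsometryEquiv.norm_map ContinuousLinearMap.adjoint b).trans_le hb

/-- Expanding the square gives `‖v‖² - 2‖b v‖² + ‖b† b v‖²`, and the last term is at most `‖b v‖²`.
-/
theorem norm_defect_sq_le {b : E →L[ℂ] E} (hb : ‖b‖ ≤ 1) (v : E) :
    ‖b v‖ ^ 2 ≤ ‖v‖ ^ 2 - ‖defect b v‖ ^ 2 := by
  have h1 : ‖star b (b v)‖ ≤ ‖b v‖ := norm_apply_le_of_norm_le_one (norm_star_le_one hb) _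
  have h2 := @norm_sub_sq ℂ E _ _ _ v (star b (b v))
  have h3 : RCLike.re (inner ℂ v (star b (b v))) = ‖b v‖ ^ 2 := re_inner_star_mul_self b v
  rw [defect_apply, h2, h3]
  nlinarith [norm_nonneg (b v), norm_nonneg (star b (b v))]

theorem norm_defect_apply_le {b : E →L[ℂ] E} (hb : ‖b‖ ≤ 1) (v : E) : ‖defect b v‖ ≤ ‖v‖ := by
  have := norm_defect_sq_le hb v
  exact le_of_sq_le_sq (by nlinarith [sq_nonneg ‖b v‖]) (norm_nonneg v)

theorem norm_apply_defect_le {b c : E →L[ℂ] E} (hb : ‖b‖ ≤ 1) (hc : ‖c‖ ≤ 1) (v : E) :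
    ‖c (defect b v)‖ ≤ ‖c v‖ + ‖b v‖ := by
  rw [defect_apply, map_sub]
  refine (norm_sub_le _ _).trans ?_
  gcongr
  exact (norm_apply_le_of_norm_le_one hc _).trans
    (norm_apply_le_of_norm_le_one (norm_star_le_one hb) _)

theorem norm_apply_defect_self_le {b : E →L[ℂ] E} (hb : ‖b‖ ≤ 1) (v : E) :
    ‖b (defect b v)‖ ≤ ‖b v‖ := by
  have : b (defect b v) = defect (star b) (b v) := by simp [defect_apply]
  rw [this]
  exact norm_defect_apply_le (norm_star_le_one hb) _

variable {κ : Type*}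

/-- The ordered product of the operators `1 - b i† b i` along a list. -/
noncomputable def defectProd (b : κ → E →L[ℂ] E) (l : List κ) : E →L[ℂ] E :=
  (l.map fun i => defect (b i)).prod

@[simp] theorem defectProd_nil (b : κ → E →L[ℂ] E) : defectProd b [] = 1 := rfl

@[simp] theorem defectProd_cons (b : κ → E →L[ℂ] E) (i : κ) (l : List κ) :
    defectProd b (i :: l) = defect (b i) * defectProd b l := by
  simp [defectProd]

theorem defectProd_append (b : κ → E →L[ℂ] E) (l m : List κ) :
    defectProd b (l ++ m) = defectProd b l * defectProd b m := by
  simp [defectProd]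

theorem star_defectProd (b : κ → E →L[ℂ] E) (l : List κ) :
    star (defectProd b l) = defectProd b l.reverse := by
  induction l with
  | nil => simp
  | cons i l ih =>
    rw [defectProd_cons, star_mul, ih, (isSelfAdjoint_defect _).star_eq, List.reverse_cons,
      defectProd_append]
    simp

theorem defectProd_apply_of_fixed (b : κ → E →L[ℂ] E) (l : List κ) {v : E}
    (h : ∀ i ∈ l, b i v = 0) : defectProd b l v = v := by
  induction l with
  | nil => simp
  | cons i l ih =>
    rw [defectProd_cons, mul_apply_eq_comp, ih fun j hj => h j (by simp [hj]),
      defect_apply_of_apply_eq_zero (h i (by simp))]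

/-- Here `e j` is `‖b j φ‖` for the vector `φ` on which the factor of `j` acts. The losses of
squared norm telescope. After the factor of `i` has acted, `‖b i ·‖` can grow only through a later
factor that fails to commute with `b i`, and then by at most `e j`. -/
theorem exists_telescoping_bound [DecidableEq κ] (b : κ → E →L[ℂ] E) (hb : ∀ i, ‖b i‖ ≤ 1)
    (N : κ → Finset κ) (ψ : E) (l : List κ) (hl : l.Nodup)
    (hcomm : ∀ i ∈ l, ∀ j ∈ l, j ∉ N i → Commute (b i) (defect (b j)))
    (hself : ∀ i ∈ l, i ∈ N i) :
    ∃ e : κ → ℝ, (∀ j, 0 ≤ e j) ∧ ∑ j ∈ l.toFinset, e j ^ 2 ≤ ‖ψ‖ ^ 2 - ‖defectProd b l ψ‖ ^ 2 ∧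
      ∀ i ∈ l, ‖b i (defectProd b l ψ)‖ ≤ ∑ j ∈ l.toFinset with j ∈ N i, e j := by
  induction l with
  | nil => exact ⟨0, by simp⟩
  | cons k l ih =>
    obtain ⟨hk, hl⟩ := List.nodup_cons.mp hl
    obtain ⟨e, he0, he, hle⟩ := ih hl (fun i hi j hj => hcomm i (by simp [hi]) j (by simp [hj]))
      fun i hi => hself i (by simp [hi])
    set φ := defectProd b l ψ with hφ
    have hkl : k ∉ l.toFinset := by simpa using hk
    have hupd : ∀ j ∈ l.toFinset, Function.update e k ‖b k φ‖ j = e j := fun j hj =>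
      Function.update_of_ne (by rintro rfl; exact hkl hj) _ _
    refine ⟨Function.update e k ‖b k φ‖, ?_, ?_, ?_⟩
    · intro j
      by_cases hj : j = k
      · subst hj; simp
      · simpa [hj] using he0 j
    · rw [List.toFinset_cons, Finset.sum_insert hkl, Function.update_self,
        Finset.sum_congr rfl fun j hj => by rw [hupd j hj], defectProd_cons,
        mul_apply_eq_comp, ← hφ]
      linarith [norm_defect_sq_le (hb k) φ]
    · have hsum : ∀ i, ∑ j ∈ l.toFinset with j ∈ N i, Function.update e k ‖b k φ‖ j =
          ∑ j ∈ l.toFinset with j ∈ N i, e j := fun i =>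
        Finset.sum_congr rfl fun j hj => hupd j (Finset.mem_filter.mp hj).1
      intro i hi
      rw [defectProd_cons, mul_apply_eq_comp, ← hφ, List.toFinset_cons,
        Finset.filter_insert]
      by_cases hik : i = k
      · subst hik
        rw [if_pos (hself i (by simp)), Finset.sum_insert (by simp [hk]), Function.update_self, hsum]
        refine (norm_apply_defect_self_le (hb i) φ).trans ?_
        exact le_add_of_nonneg_right (Finset.sum_nonneg fun j _ => he0 j)
      · have hil : i ∈ l := by simpa [hik] using hi
        split_ifs with hki
        · rw [Finset.sum_insert (by simp [hk]), Function.update_self, hsum]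
          linarith [norm_apply_defect_le (hb k) (hb i) φ, hle i hil]
        · rw [hsum]
          refine le_trans ?_ (hle i hil)
          have := hcomm i hi k (by simp) hki
          rw [← mul_apply_eq_comp, this.eq, mul_apply_eq_comp]
          exact norm_defect_apply_le (hb k) _

/-- The detectability lemma: if `ψ` loses little norm under the product of the operators
`1 - b i† b i`, then the resulting vector has small energy. -/
theorem sum_norm_sq_apply_defectProd_le [DecidableEq κ] (b : κ → E →L[ℂ] E) (hb : ∀ i, ‖b i‖ ≤ 1)
    (N : κ → Finset κ) (ψ : E) (l : List κ) (hl : l.Nodup)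
    (hcomm : ∀ i ∈ l, ∀ j ∈ l, j ∉ N i → Commute (b i) (defect (b j)))
    (hself : ∀ i ∈ l, i ∈ N i) (hsymm : ∀ i ∈ l, ∀ j ∈ l, j ∈ N i → i ∈ N j) (g : ℕ)
    (hg : ∀ i ∈ l, (N i).card ≤ g) :
    ∑ i ∈ l.toFinset, ‖b i (defectProd b l ψ)‖ ^ 2 ≤
      (g : ℝ) ^ 2 * (‖ψ‖ ^ 2 - ‖defectProd b l ψ‖ ^ 2) := by
  obtain ⟨e, he0, he, hle⟩ := exists_telescoping_bound b hb N ψ l hl hcomm hself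
  calc ∑ i ∈ l.toFinset, ‖b i (defectProd b l ψ)‖ ^ 2
      ≤ ∑ i ∈ l.toFinset, (g : ℝ) * ∑ j ∈ l.toFinset with j ∈ N i, e j ^ 2 := by
        refine Finset.sum_le_sum fun i hi => ?_
        have hi : i ∈ l := by simpa using hi
        calc ‖b i (defectProd b l ψ)‖ ^ 2 ≤ (∑ j ∈ l.toFinset with j ∈ N i, e j) ^ 2 := by
              gcongr; exact hle i hi
          _ ≤ _ := sq_sum_le_card_mul_sum_sq
          _ ≤ _ := by
              gcongr
              exact (Finset.card_le_card fun j hj => (Finset.mem_filter.mp hj).2).trans (hg i hi)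
    _ = (g : ℝ) * ∑ j ∈ l.toFinset, ∑ i ∈ l.toFinset with j ∈ N i, e j ^ 2 := by
        rw [← Finset.mul_sum]
        simp_rw [Finset.sum_filter]
        rw [Finset.sum_comm]
    -- By symmetry of `N`, each `e j` is counted for at most `g` indices `i`.
    _ ≤ (g : ℝ) * ∑ j ∈ l.toFinset, (g : ℝ) * e j ^ 2 := by
        gcongr with j hj
        rw [Finset.sum_const, nsmul_eq_mul]
        gcongr
        refine (Finset.card_le_card fun i hi => ?_).trans (hg j (by simpa using hj))
        exact hsymm i (by simpa using (Finset.mem_filter.mp hi).1) j (by simpa using hj)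
          (Finset.mem_filter.mp hi).2
    _ = (g : ℝ) ^ 2 * ∑ j ∈ l.toFinset, e j ^ 2 := by rw [← Finset.mul_sum]; ring
    _ ≤ _ := by gcongr

end Detectability

/-! ### Finite propagation of the two-layer products. -/

section Peeling

variable {E : Type*} [NormedAddCommGroup E] [InnerProductSpace ℂ E] [CompleteSpace E]
  {κ : Type*} {b : κ → E →L[ℂ] E} {σ : κ → ℤ}

/-- Within a layer, a factor at a low position commutes with all factors at high ones, so it can be
moved onto `z`, which it fixes. -/
theorem defectProd_apply_eq_filter {l : List κ} {J : ℤ} {z : E}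
    (hcomm : ∀ i ∈ l, ∀ j ∈ l, 2 ≤ σ j - σ i → Commute (defect (b i)) (defect (b j)))
    (hsep : ∀ i ∈ l, ∀ j ∈ l, σ i < σ j → 2 ≤ σ j - σ i)
    (hz : ∀ i ∈ l, σ i ≤ J → defect (b i) z = z) :
    defectProd b l z = defectProd b (l.filter fun i => J < σ i) z := by
  induction l with
  | nil => simp
  | cons i l ih =>
    rw [defectProd_cons, mul_apply_eq_comp,
      ih (fun k hk j hj => hcomm k (by simp [hk]) j (by simp [hj]))
      (fun k hk j hj => hsep k (by simp [hk]) j (by simp [hj])) fun k hk => hz k (by simp [hk])]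
    by_cases hi : J < σ i
    · rw [List.filter_cons_of_pos (by simpa using hi), defectProd_cons, mul_apply_eq_comp]
    · rw [List.filter_cons_of_neg (by simpa using hi), ← mul_apply_eq_comp]
      have : Commute (defect (b i)) (defectProd b (l.filter fun i => J < σ i)) := by
        refine Commute.list_prod_right _ _ fun a ha => ?_
        obtain ⟨j, hj, rfl⟩ := List.mem_map.mp ha
        obtain ⟨hj, hJ⟩ := List.mem_filter.mp hj
        have hJ : J < σ j := by simpa using hJ
        exact hcomm i (by simp) j (by simp [hj]) (hsep i (by simp) j (by simp [hj]) (by omega))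
      rw [this.eq, mul_apply_eq_comp, hz i (by simp) (by omega)]

/-- A layer of operators with separated positions is invisible to a vector `x` fixed by all
operators at high positions, and moves the fixed region of `z` by one unit. -/
theorem inner_layer {I : Finset κ} {l : List κ} (hlI : ∀ i ∈ l, i ∈ I) {J : ℤ} {x z : E}
    (hcomm : ∀ i ∈ I, ∀ j ∈ I, 2 ≤ σ j - σ i → Commute (defect (b i)) (defect (b j)))
    (hsep : ∀ i ∈ l, ∀ j ∈ l, σ i < σ j → 2 ≤ σ j - σ i)
    (hx : ∀ i ∈ I, J < σ i → defect (b i) x = x)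
    (hz : ∀ i ∈ I, σ i ≤ J → defect (b i) z = z) :
    inner ℂ x (defectProd b l z) = inner ℂ x z ∧
      ∀ i ∈ I, σ i ≤ J - 1 → defect (b i) (defectProd b l z) = defectProd b l z := by
  rw [defectProd_apply_eq_filter (fun i hi j hj => hcomm i (hlI i hi) j (hlI j hj)) hsep
    fun i hi => hz i (hlI i hi)]
  have hm : ∀ i ∈ l.filter fun i => J < σ i, i ∈ I ∧ J < σ i := fun i hi => by
    obtain ⟨hi, hJ⟩ := List.mem_filter.mp hi
    exact ⟨hlI i hi, by simpa using hJ⟩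
  generalize l.filter (fun i => J < σ i) = m at hm
  constructor
  · induction m with
    | nil => simp
    | cons i m ih =>
      rw [defectProd_cons, mul_apply_eq_comp, inner_defect_apply,
        hx i (hm i (by simp)).1 (hm i (by simp)).2, ih fun j hj => hm j (by simp [hj])]
  -- Positions `≤ J - 1` and `> J` differ by at least 2, so the factors commute; position `J` itself
  -- is lost.
  · intro i hi hiJ
    have : Commute (defect (b i)) (defectProd b m) := by
      refine Commute.list_prod_right _ _ fun a ha => ?_
      obtain ⟨j, hj, rfl⟩ := List.mem_map.mp ha
      exact hcomm i hi j (hm j hj).1 (by have := (hm j hj).2; omega)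
    rw [← mul_apply_eq_comp, this.eq, mul_apply_eq_comp, hz i hi (by omega)]

/-- One application of `M† M` consists of four layers, and each moves the edge of the region where
`z` is fixed by one; `x` absorbs the layers as long as that edge stays at or above `J`. -/
theorem inner_pow_layers {I : Finset κ} {l m : List κ} (hlI : ∀ i ∈ l, i ∈ I)
    (hmI : ∀ i ∈ m, i ∈ I) {J : ℤ} {x z : E} (n : ℕ)
    (hcomm : ∀ i ∈ I, ∀ j ∈ I, 2 ≤ σ j - σ i → Commute (defect (b i)) (defect (b j)))
    (hl : ∀ i ∈ l, ∀ j ∈ l, σ i < σ j → 2 ≤ σ j - σ i)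
    (hm : ∀ i ∈ m, ∀ j ∈ m, σ i < σ j → 2 ≤ σ j - σ i)
    (hx : ∀ i ∈ I, J < σ i → defect (b i) x = x)
    (hz : ∀ i ∈ I, σ i ≤ J + 4 * n → defect (b i) z = z) :
    inner ℂ x (((star (defectProd b (l ++ m)) * defectProd b (l ++ m)) ^ n) z) = inner ℂ x z := by
  induction n generalizing z with
  | zero => simp
  | succ n ih =>
    rw [pow_succ, mul_apply_eq_comp]
    set a := J + 4 * n with ha
    have hz : ∀ i ∈ I, σ i ≤ a + 4 → defect (b i) z = z := fun i hi h =>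
      hz i hi (by push_cast; omega)
    have hx' : ∀ c, a < c → ∀ i ∈ I, c < σ i → defect (b i) x = x := fun c hc i hi h =>
      hx i hi (by omega)
    obtain ⟨e1, h1⟩ := inner_layer hmI hcomm hm (hx' (a + 4) (by omega)) hz
    obtain ⟨e2, h2⟩ := inner_layer hlI hcomm hl (hx' _ (by omega)) h1
    obtain ⟨e3, h3⟩ := inner_layer (l := l.reverse) (by simpa using hlI) hcomm
      (by simpa using hl) (hx' _ (by omega)) h2
    obtain ⟨e4, h4⟩ := inner_layer (l := m.reverse) (by simpa using hmI) hcomm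
      (by simpa using hm) (hx' _ (by omega)) h3
    have hK : (star (defectProd b (l ++ m)) * defectProd b (l ++ m)) z =
        defectProd b m.reverse (defectProd b l.reverse (defectProd b l (defectProd b m z))) := by
      rw [star_defectProd, List.reverse_append, defectProd_append, defectProd_append]
      simp only [mul_apply_eq_comp]
    rw [hK, ih fun i hi h => h4 i hi (by omega), e4, e3, e2, e1]

end Peeling

/-! ### Polynomials that are small on an interval and equal to 1 at 1. -/

section Chebyshev

open Polynomial

theorem one_add_sq_mul_le_eval_chebyshev {y : ℝ} (hy : 0 ≤ y) (n : ℕ) :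
    1 + (n : ℝ) ^ 2 * y ≤ (Chebyshev.T ℝ n).eval (1 + y) := by
  -- The increments obey `T_{n+2} - T_{n+1} = (T_{n+1} - T_n) + 2 y T_{n+1}` at `1 + y`, so the
  -- induction also carries a lower bound on them.
  have key : ∀ n : ℕ, 1 + (n : ℝ) ^ 2 * y ≤ (Chebyshev.T ℝ n).eval (1 + y) ∧
      (2 * (n : ℝ) + 1) * y ≤
        (Chebyshev.T ℝ (n + 1)).eval (1 + y) - (Chebyshev.T ℝ n).eval (1 + y) := by
    intro n
    induction n with
    | zero => simp
    | succ n ih =>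
      obtain ⟨h1, h2⟩ := ih
      have h3 : 1 + ((n : ℝ) + 1) ^ 2 * y ≤ (Chebyshev.T ℝ (n + 1)).eval (1 + y) := by
        nlinarith
      push_cast
      refine ⟨h3, ?_⟩
      rw [add_assoc (n : ℤ) 1 1, show (1 + 1 : ℤ) = 2 from rfl, Chebyshev.T_add_two]
      simp only [eval_sub, eval_mul, eval_ofNat, eval_X]
      have h4 : 1 ≤ (Chebyshev.T ℝ (n + 1)).eval (1 + y) :=
        le_trans (by nlinarith [sq_nonneg ((n : ℝ) + 1)]) h3
      nlinarith
  exact (key n).1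

/-- Take `T_n(2(1+y)t - 1) / T_n(1+2y)`: the affine map sends `[0, 1/(1+y)]` to `[-1, 1]` and 1 to
`1 + 2y`. -/
theorem exists_polynomial_small {y : ℝ} (hy : 0 ≤ y) (n : ℕ) :
    ∃ p : ℝ[X], p.natDegree ≤ n ∧ p.eval 1 = 1 ∧
      ∀ t, 0 ≤ t → t ≤ 1 / (1 + y) → |p.eval t| ≤ 1 / (1 + 2 * (n : ℝ) ^ 2 * y) := by
  set c := (Chebyshev.T ℝ n).eval (1 + 2 * y) with hc
  have hle : 1 + 2 * (n : ℝ) ^ 2 * y ≤ c := by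
    have := one_add_sq_mul_le_eval_chebyshev (y := 2 * y) (by positivity) n
    linarith
  have hpos : 0 < 1 + 2 * (n : ℝ) ^ 2 * y := by positivity
  refine ⟨C c⁻¹ * (Chebyshev.T ℝ n).comp (C (2 * (1 + y)) * X - 1), ?_, ?_, ?_⟩
  · refine (natDegree_C_mul_le _ _).trans (natDegree_comp_le.trans ?_)
    rw [Chebyshev.natDegree_T]
    have : (C (2 * (1 + y)) * X - 1 : ℝ[X]).natDegree ≤ 1 := by compute_degree
    simpa using Nat.mul_le_mul_left n this
  · simp only [eval_mul, eval_C, eval_comp, eval_sub, eval_X, eval_one]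
    rw [show 2 * (1 + y) * 1 - 1 = 1 + 2 * y by ring, ← hc]
    exact inv_mul_cancel₀ (by linarith)
  · intro t ht0 ht
    simp only [eval_mul, eval_C, eval_comp, eval_sub, eval_X, eval_one]
    have h1 : t * (1 + y) ≤ 1 := by rwa [le_div_iff₀ (by positivity)] at ht
    have h2 : 0 ≤ t * (1 + y) := by positivity
    have h3 := Chebyshev.abs_eval_T_real_le_one n (x := 2 * (1 + y) * t - 1)
      (abs_le.mpr ⟨by nlinarith, by nlinarith⟩)
    rw [abs_mul, abs_of_pos (inv_pos.mpr (by linarith)), one_div]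
    calc c⁻¹ * _ ≤ c⁻¹ * 1 := by
          gcongr
          exact inv_nonneg.mpr (by linarith)
      _ ≤ _ := by rw [mul_one]; gcongr

end Chebyshev

/-! ### Polynomial functional calculus on an invariant subspace. -/

section Spectral

open Polynomial

/-- In an eigenbasis `p(S)` is diagonal, and the bounds on the quadratic form confine the
eigenvalues to `[0, β]`. -/
theorem norm_aeval_apply_le {W : Type*} [NormedAddCommGroup W] [InnerProductSpace ℂ W]
    [FiniteDimensional ℂ W] {S : W →ₗ[ℂ] W} (hS : S.IsSymmetric) {β δ : ℝ}
    (h0 : ∀ w, 0 ≤ (inner ℂ w (S w)).re) (hβ : ∀ w, (inner ℂ w (S w)).re ≤ β * ‖w‖ ^ 2)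
    {p : ℝ[X]} (hp : ∀ t, 0 ≤ t → t ≤ β → |p.eval t| ≤ δ) (hδ : 0 ≤ δ) (y : W) :
    ‖aeval S (p.map Complex.ofRealHom) y‖ ≤ δ * ‖y‖ := by
  set e := hS.eigenvectorBasis rfl
  set ev := hS.eigenvalues rfl
  have heig : ∀ i, Module.End.HasEigenvector S (ev i : ℂ) (e i) := fun i =>
    hS.hasEigenvector_eigenvectorBasis rfl i
  have hbound : ∀ i, |p.eval (ev i)| ≤ δ := fun i => by
    have h1 : (inner ℂ (e i) (S (e i))).re = ev i := by
      rw [(heig i).apply_eq_smul, inner_smul_right, inner_self_eq_norm_sq_to_K]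
      simp
    have h2 := h0 (e i)
    have h3 := hβ (e i)
    rw [h1] at h2 h3
    exact hp _ h2 (by simpa using h3)
  have hcoef : ∀ i, inner ℂ (e i) (aeval S (p.map Complex.ofRealHom) y) =
      ((p.eval (ev i) : ℝ) : ℂ) * inner ℂ (e i) y := by
    intro i
    conv_lhs => rw [← e.sum_repr' y]
    rw [map_sum, inner_sum, Finset.sum_eq_single i]
    · rw [map_smul, Module.End.aeval_apply_of_hasEigenvector (heig i), inner_smul_right,
        inner_smul_right, inner_self_eq_norm_sq_to_K]
      have : (p.map Complex.ofRealHom).eval (ev i : ℂ) = ((p.eval (ev i) : ℝ) : ℂ) := by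
        simpa using eval_map_apply Complex.ofRealHom (p := p) (ev i)
      simp [this, mul_comm]
    · intro j _ hj
      rw [map_smul, Module.End.aeval_apply_of_hasEigenvector (heig j), inner_smul_right,
        inner_smul_right, e.inner_eq_zero hj.symm]
      simp
    · simp
  refine le_of_sq_le_sq ?_ (by positivity)
  rw [mul_pow, ← e.sum_sq_norm_inner_right, ← e.sum_sq_norm_inner_right y, Finset.mul_sum]
  refine Finset.sum_le_sum fun i _ => ?_
  rw [hcoef, norm_mul, mul_pow, Complex.norm_real, Real.norm_eq_abs]
  gcongr
  exact hbound i

variable {E : Type*} [NormedAddCommGroup E] [InnerProductSpace ℂ E] [FiniteDimensional ℂ E]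

/-- As the coefficients of `p` sum to `p(1) = 1`, the hypothesis gives `⟨u, p(K) v⟩ = ⟨u, v⟩`, while
`p(K)` is small on `W`. -/
theorem norm_inner_le_of_pow {K : E →L[ℂ] E} (hK : IsSelfAdjoint K) {W : Submodule ℂ E}
    (hW : ∀ w ∈ W, K w ∈ W) {y : ℝ} (hy : 0 ≤ y)
    (h0 : ∀ w, 0 ≤ (inner ℂ w (K w)).re)
    (hβ : ∀ w ∈ W, (inner ℂ w (K w)).re ≤ 1 / (1 + y) * ‖w‖ ^ 2) {n : ℕ} {u v : E} (hv : v ∈ W)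
    (huv : ∀ j ≤ n, inner ℂ u ((K ^ j) v) = inner ℂ u v) :
    ‖inner ℂ u v‖ ≤ 1 / (1 + 2 * (n : ℝ) ^ 2 * y) * (‖u‖ * ‖v‖) := by
  obtain ⟨p, hdeg, hp1, hp⟩ := exists_polynomial_small hy n
  set S : W →ₗ[ℂ] W := (K : E →ₗ[ℂ] E).restrict hW
  have hS : S.IsSymmetric := fun a c => hK.isSymmetric a c
  have hpow : ∀ j, (((S ^ j) ⟨v, hv⟩ : W) : E) = (K ^ j) v := by
    intro j
    induction j with
    | zero => simp
    | succ j ih =>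
      rw [pow_succ' K, mul_apply_eq_comp, ← ih, pow_succ']
      rfl
  have hb := norm_aeval_apply_le hS (fun w => h0 w) (fun w => hβ w w.2) hp (by positivity) ⟨v, hv⟩
  have hinner : inner ℂ u ((aeval S (p.map Complex.ofRealHom) ⟨v, hv⟩ : W) : E) = inner ℂ u v := by
    rw [aeval_eq_sum_range' (n := n + 1) (by
      refine lt_of_le_of_lt natDegree_map_le (by omega))]
    rw [LinearMap.sum_apply, Submodule.coe_sum, inner_sum]
    have : ∀ j ∈ Finset.range (n + 1), inner ℂ u (((((p.map Complex.ofRealHom).coeff j • S ^ j)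
        ⟨v, hv⟩ : W)) : E) = (p.coeff j : ℂ) * inner ℂ u v := by
      intro j hj
      rw [LinearMap.smul_apply, Submodule.coe_smul, inner_smul_right, hpow,
        huv j (by simpa [Nat.lt_succ_iff] using hj)]
      simp
    rw [Finset.sum_congr rfl this, ← Finset.sum_mul]
    have h1 : ∑ j ∈ Finset.range (n + 1), p.coeff j = 1 := by
      rw [← hp1, eval_eq_sum_range' (n := n + 1) (by omega)]
      simp
    rw [← Complex.ofReal_sum, h1]
    simp
  rw [← hinner]
  refine (norm_inner_le_norm _ _).trans ?_
  have : ‖((aeval S (p.map Complex.ofRealHom) ⟨v, hv⟩ : W) : E)‖ ≤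
    1 / (1 + 2 * (n : ℝ) ^ 2 * y) * ‖v‖ := hb
  calc ‖u‖ * _ ≤ ‖u‖ * (1 / (1 + 2 * (n : ℝ) ^ 2 * y) * ‖v‖) := by gcongr
    _ = _ := by ring

end Spectral

/-! ### Ground spaces of overlapping regions and the averaged cut. -/

section Cut

variable {E : Type*} [NormedAddCommGroup E] [InnerProductSpace ℂ E] [FiniteDimensional ℂ E]
  {κ : Type*}

/-- The Hamiltonian `∑_{i ∈ I} b i† b i`. -/
noncomputable def energy (b : κ → E →L[ℂ] E) (I : Finset κ) : E →L[ℂ] E :=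
  ∑ i ∈ I, star (b i) * b i

theorem re_inner_energy (b : κ → E →L[ℂ] E) (I : Finset κ) (v : E) :
    (inner ℂ v (energy b I v)).re = ∑ i ∈ I, ‖b i v‖ ^ 2 := by
  rw [energy, sum_apply, inner_sum, Complex.re_sum]
  exact Finset.sum_congr rfl fun i _ => re_inner_star_mul_self (b i) v

/-- The common kernel of the operators `b i`, `i ∈ I`. -/
noncomputable def ground (b : κ → E →L[ℂ] E) (I : Finset κ) : Submodule ℂ E :=
  LinearMap.ker (energy b I : E →ₗ[ℂ] E)

theorem mem_ground {b : κ → E →L[ℂ] E} {I : Finset κ} {v : E} :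
    v ∈ ground b I ↔ ∀ i ∈ I, b i v = 0 := by
  constructor
  · intro h i hi
    have h0 : energy b I v = 0 := h
    have := re_inner_energy b I v
    rw [h0, inner_zero_right, Complex.zero_re, eq_comm,
      Finset.sum_eq_zero_iff_of_nonneg fun i _ => sq_nonneg _] at this
    simpa using this i hi
  · intro h
    change energy b I v = 0
    rw [energy, sum_apply]
    exact Finset.sum_eq_zero fun i hi => by rw [mul_apply_eq_comp, h i hi, map_zero]

theorem ground_anti (b : κ → E →L[ℂ] E) {I J : Finset κ} (h : J ⊆ I) :
    ground b I ≤ ground b J := fun _ hv =>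
  mem_ground.mpr fun i hi => mem_ground.mp hv i (h hi)

/-- The quadratic form of `∑_{i ∈ I} b i† b i` is at least `r` off its kernel. -/
def HasGap (b : κ → E →L[ℂ] E) (I : Finset κ) (r : ℝ) : Prop :=
  ∀ v ∈ (ground b I)ᗮ, r * ‖v‖ ^ 2 ≤ ∑ i ∈ I, ‖b i v‖ ^ 2

theorem HasGap.le_sum {b : κ → E →L[ℂ] E} {I : Finset κ} {r : ℝ} (h : HasGap b I r) (v : E) :
    r * (‖v‖ ^ 2 - ‖(ground b I).starProjection v‖ ^ 2) ≤ ∑ i ∈ I, ‖b i v‖ ^ 2 := by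
  set P := (ground b I).starProjection v with hP
  have h1 := h _ ((ground b I).sub_starProjection_mem_orthogonal v)
  have h2 : ∀ i ∈ I, b i (v - P) = b i v := fun i hi => by
    rw [map_sub, mem_ground.mp ((ground b I).starProjection_apply_mem v) i hi, sub_zero]
  rw [← hP, Finset.sum_congr rfl fun i hi => by rw [h2 i hi]] at h1
  have h3 := (ground b I).norm_sq_eq_add_norm_sq_starProjection v
  rw [Submodule.starProjection_orthogonal_val, ← hP] at h3
  rw [h3]
  simpa using h1

/-- The adjoint is the reversed product, which fixes every ground vector. -/
theorem defectProd_mem_orthogonal {b : κ → E →L[ℂ] E} {I : Finset κ} {l : List κ}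
    (hl : ∀ i ∈ l, i ∈ I) {w : E} (hw : w ∈ (ground b I)ᗮ) :
    defectProd b l w ∈ (ground b I)ᗮ := by
  rw [Submodule.mem_orthogonal] at hw ⊢
  intro u hu
  rw [← ContinuousLinearMap.adjoint_inner_left, ← ContinuousLinearMap.star_eq_adjoint,
    star_defectProd, defectProd_apply_of_fixed]
  · exact hw u hu
  · exact fun i hi => mem_ground.mp hu i (hl i (by simpa using hi))

/-- The image of `w` stays orthogonal to the ground space, so its energy is at least `γ` times its
squared norm; the detectability lemma bounds the same energy by `g²` times the loss of squared norm.
-/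
theorem norm_defectProd_sq_le [DecidableEq κ] {b : κ → E →L[ℂ] E} (hb : ∀ i, ‖b i‖ ≤ 1)
    (N : κ → Finset κ) {I : Finset κ} (hself : ∀ i ∈ I, i ∈ N i)
    (hsymm : ∀ i ∈ I, ∀ j ∈ I, j ∈ N i → i ∈ N j) {g : ℕ} (hg1 : 1 ≤ g) (hg : ∀ i ∈ I, (N i).card ≤ g)
    (hcomm : ∀ i ∈ I, ∀ j ∈ I, j ∉ N i → Commute (b i) (defect (b j)))
    {γ : ℝ} (hγ : 0 ≤ γ) (hgap : HasGap b I γ) {l : List κ} (hl : l.Nodup)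
    (hlI : l.toFinset = I) {w : E} (hw : w ∈ (ground b I)ᗮ) :
    ‖defectProd b l w‖ ^ 2 ≤ 1 / (1 + γ / (g : ℝ) ^ 2) * ‖w‖ ^ 2 := by
  have hmem : ∀ i, i ∈ l ↔ i ∈ I := fun i => by rw [← hlI, List.mem_toFinset]
  have h1 := sum_norm_sq_apply_defectProd_le b hb N w l hl
    (fun i hi j hj => hcomm i ((hmem i).mp hi) j ((hmem j).mp hj)) (fun i hi => hself i ((hmem i).mp hi))
    (fun i hi j hj => hsymm i ((hmem i).mp hi) j ((hmem j).mp hj)) g fun i hi => hg i ((hmem i).mp hi)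
  rw [hlI] at h1
  have h2 := hgap _ (defectProd_mem_orthogonal (fun i hi => (hmem i).mp hi) hw)
  have hg0 : (0 : ℝ) < (g : ℝ) ^ 2 := by positivity
  have h3 : γ / (g : ℝ) ^ 2 * ‖defectProd b l w‖ ^ 2 ≤ ‖w‖ ^ 2 - ‖defectProd b l w‖ ^ 2 := by
    rw [div_mul_eq_mul_div, div_le_iff₀ hg0]
    linarith
  rw [one_div, ← div_eq_inv_mul, le_div_iff₀ (by positivity)]
  linarith

/-- For two subspaces whose vectors are almost orthogonal inside `W`, the projections of `v ∈ W`
carry total weight at most `1 + δ`. -/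
theorem norm_sq_starProjection_add_le {A B : Submodule ℂ E} {W : Submodule ℂ E} {δ : ℝ}
    (hδ : 0 ≤ δ)
    (hAB : ∀ x ∈ A, x ∈ W → ∀ y ∈ B, y ∈ W → ‖inner ℂ x y‖ ≤ δ * (‖x‖ * ‖y‖))
    {v : E} (hvA : A.starProjection v ∈ W) (hvB : B.starProjection v ∈ W) :
    ‖A.starProjection v‖ ^ 2 + ‖B.starProjection v‖ ^ 2 ≤ (1 + δ) * ‖v‖ ^ 2 := by
  set x := A.starProjection v
  set y := B.starProjection v
  have hx : (inner ℂ v x).re = ‖x‖ ^ 2 := by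
    have := A.re_inner_starProjection_eq_normSq v
    rw [← inner_conj_symm, Complex.conj_re]
    exact this
  have hy : (inner ℂ v y).re = ‖y‖ ^ 2 := by
    have := B.re_inner_starProjection_eq_normSq v
    rw [← inner_conj_symm, Complex.conj_re]
    exact this
  have hxy := hAB x (A.starProjection_apply_mem v) hvA y (B.starProjection_apply_mem v) hvB
  have hre : (inner ℂ x y).re ≤ δ * (‖x‖ * ‖y‖) := (Complex.re_le_norm _).trans hxy
  have hadd : ‖x + y‖ ^ 2 = ‖x‖ ^ 2 + 2 * (inner ℂ x y).re + ‖y‖ ^ 2 :=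
    @norm_add_sq ℂ E _ _ _ x y
  -- Since `x` and `y` are projections of `v`, the left side is `Re ⟨v, x + y⟩`.
  have hcs : ‖x‖ ^ 2 + ‖y‖ ^ 2 ≤ ‖v‖ * ‖x + y‖ := by
    rw [← hx, ← hy, ← Complex.add_re, ← inner_add_right]
    exact (Complex.re_le_norm _).trans (norm_inner_le_norm _ _)
  have hS : ‖x + y‖ ^ 2 ≤ (1 + δ) * (‖x‖ ^ 2 + ‖y‖ ^ 2) := by
    nlinarith [mul_nonneg hδ (sq_nonneg (‖x‖ - ‖y‖))]
  set S := ‖x‖ ^ 2 + ‖y‖ ^ 2 with hSdef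
  have hS0 : 0 ≤ S := by positivity
  rcases hS0.eq_or_lt with h | h
  · rw [← h]; positivity
  · have : S * S ≤ S * ((1 + δ) * ‖v‖ ^ 2) := by
      calc S * S ≤ (‖v‖ * ‖x + y‖) * (‖v‖ * ‖x + y‖) := by gcongr
        _ = ‖v‖ ^ 2 * ‖x + y‖ ^ 2 := by ring
        _ ≤ ‖v‖ ^ 2 * ((1 + δ) * S) := by gcongr
        _ = _ := by ring
    exact le_of_mul_le_mul_left this h

theorem commute_defect {b c : E →L[ℂ] E} (h : Commute b c) (h' : Commute b (star c)) :
    Commute b (defect c) :=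
  (Commute.one_right _).sub_right (h'.mul_right h)

theorem starProjection_mem_orthogonal_of_le {A U : Submodule ℂ E} (h : U ≤ A) {v : E}
    (hv : v ∈ Uᗮ) : A.starProjection v ∈ Uᗮ := by
  rw [Submodule.mem_orthogonal] at hv ⊢
  intro u hu
  rw [← Submodule.inner_starProjection_left_eq_right,
    Submodule.starProjection_eq_self_iff.mpr (h hu)]
  exact hv u hu

/-- Terms are split by the parity of their strip, so that different strips within a layer differ by
at least 2. Then `x` is fixed above `J` and `y` up to `J + 4 n`, as the peeling argument requires.
-/
theorem norm_inner_ground_le [DecidableEq κ] {b : κ → E →L[ℂ] E} (hb : ∀ i, ‖b i‖ ≤ 1)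
    (N : κ → Finset κ) {I : Finset κ} (hself : ∀ i ∈ I, i ∈ N i)
    (hsymm : ∀ i ∈ I, ∀ j ∈ I, j ∈ N i → i ∈ N j) {g : ℕ} (hg1 : 1 ≤ g) (hg : ∀ i ∈ I, (N i).card ≤ g)
    (hcomm : ∀ i ∈ I, ∀ j ∈ I, j ∉ N i → Commute (b i) (b j) ∧ Commute (b i) (star (b j)))
    {γ : ℝ} (hγ : 0 ≤ γ) (hgap : HasGap b I γ)
    (σ : κ → ℤ) (hσ : ∀ i ∈ I, ∀ j ∈ I, 2 ≤ σ j - σ i → j ∉ N i)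
    {IA IB : Finset κ} {J : ℤ} {n : ℕ}
    (hA : ∀ i ∈ I, J < σ i → i ∈ IA) (hB : ∀ i ∈ I, σ i ≤ J + 4 * n → i ∈ IB)
    {x y : E} (hx : x ∈ ground b IA) (hy : y ∈ ground b IB) (hyI : y ∈ (ground b I)ᗮ) :
    ‖inner ℂ x y‖ ≤ 1 / (1 + 2 * (n : ℝ) ^ 2 * (γ / (g : ℝ) ^ 2)) * (‖x‖ * ‖y‖) := by
  set l := (I.filter fun i => Even (σ i)).toList
  set m := (I.filter fun i => ¬ Even (σ i)).toList
  have hl : ∀ i ∈ l, i ∈ I ∧ Even (σ i) := fun i hi => by simpa [l] using hi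
  have hm : ∀ i ∈ m, i ∈ I ∧ ¬ Even (σ i) := fun i hi => by simpa [m] using hi
  have hlm : ∀ i ∈ l ++ m, i ∈ I := fun i hi =>
    (List.mem_append.mp hi).elim (fun h => (hl i h).1) fun h => (hm i h).1
  have hnodup : (l ++ m).Nodup := List.Nodup.append (Finset.nodup_toList _) (Finset.nodup_toList _)
    fun i h1 h2 => (hm i h2).2 (hl i h1).2
  have hfin : (l ++ m).toFinset = I := by
    rw [List.toFinset_append, Finset.toList_toFinset, Finset.toList_toFinset,
      Finset.filter_union_filter_not_eq]
  have hc1 : ∀ i ∈ I, ∀ j ∈ I, j ∉ N i → Commute (b i) (defect (b j)) := fun i hi j hj h =>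
    commute_defect (hcomm i hi j hj h).1 (hcomm i hi j hj h).2
  have hc2 : ∀ i ∈ I, ∀ j ∈ I, 2 ≤ σ j - σ i → Commute (defect (b i)) (defect (b j)) := by
    intro i hi j hj h
    have h1 := hc1 i hi j hj (hσ i hi j hj h)
    have h2 : Commute (star (b i)) (defect (b j)) := by
      have := h1.star_star
      rwa [(isSelfAdjoint_defect _).star_eq] at this
    exact (Commute.one_left _).sub_left (h2.mul_left h1)
  set M := defectProd b (l ++ m)
  refine norm_inner_le_of_pow (K := star M * M) (IsSelfAdjoint.star_mul_self M)
    (W := (ground b I)ᗮ) ?_ (by positivity) ?_ ?_ hyI ?_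
  · intro w hw
    rw [mul_apply_eq_comp, star_defectProd]
    exact defectProd_mem_orthogonal (fun i hi => hlm i (List.mem_reverse.mp hi))
      (defectProd_mem_orthogonal hlm hw)
  · intro w
    rw [mul_apply_eq_comp, re_inner_star_mul_self]
    positivity
  · intro w hw
    rw [mul_apply_eq_comp, re_inner_star_mul_self]
    exact norm_defectProd_sq_le hb N hself hsymm hg1 hg hc1 hγ hgap hnodup hfin hw
  · intro j hj
    refine inner_pow_layers (fun i hi => (hl i hi).1) (fun i hi => (hm i hi).1) (J := J) j hc2
      ?_ ?_ ?_ ?_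
    · intro i hi k hk h
      have h1 := Int.even_iff.mp (hl i hi).2
      have h2 := Int.even_iff.mp (hl k hk).2
      omega
    · intro i hi k hk h
      have h1 := Int.not_even_iff.mp (hm i hi).2
      have h2 := Int.not_even_iff.mp (hm k hk).2
      omega
    · exact fun i hi h => defect_apply_of_apply_eq_zero (mem_ground.mp hx i (hA i hi h))
    · exact fun i hi h => defect_apply_of_apply_eq_zero
        (mem_ground.mp hy i (hB i hi (by omega)))

/-- Cutting a region into two overlapping ones: the sum of the two local energies is bounded below
in terms of the local gap and the width `4 n` of the overlap. -/
theorem cut_energy_le [DecidableEq κ] {b : κ → E →L[ℂ] E} (hb : ∀ i, ‖b i‖ ≤ 1)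
    (N : κ → Finset κ) {I : Finset κ} (hself : ∀ i ∈ I, i ∈ N i)
    (hsymm : ∀ i ∈ I, ∀ j ∈ I, j ∈ N i → i ∈ N j) {g : ℕ} (hg1 : 1 ≤ g) (hg : ∀ i ∈ I, (N i).card ≤ g)
    (hcomm : ∀ i ∈ I, ∀ j ∈ I, j ∉ N i → Commute (b i) (b j) ∧ Commute (b i) (star (b j)))
    {γ : ℝ} (hγ : 0 ≤ γ) (hgap : HasGap b I γ)
    (σ : κ → ℤ) (hσ : ∀ i ∈ I, ∀ j ∈ I, 2 ≤ σ j - σ i → j ∉ N i)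
    {IA IB : Finset κ} (hIA : IA ⊆ I) (hIB : IB ⊆ I) {J : ℤ} {n : ℕ}
    (hA : ∀ i ∈ I, J < σ i → i ∈ IA) (hB : ∀ i ∈ I, σ i ≤ J + 4 * n → i ∈ IB)
    {r : ℝ} (hr : 0 ≤ r) (hgA : HasGap b IA r) (hgB : HasGap b IB r)
    {v : E} (hv : v ∈ (ground b I)ᗮ) :
    r * (1 - 1 / (1 + 2 * (n : ℝ) ^ 2 * (γ / (g : ℝ) ^ 2))) * ‖v‖ ^ 2 ≤
      ∑ i ∈ IA, ‖b i v‖ ^ 2 + ∑ i ∈ IB, ‖b i v‖ ^ 2 := by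
  set δ := 1 / (1 + 2 * (n : ℝ) ^ 2 * (γ / (g : ℝ) ^ 2))
  have hδ : 0 ≤ δ := by positivity
  have h1 := norm_sq_starProjection_add_le (A := ground b IA) (B := ground b IB)
    (W := (ground b I)ᗮ) hδ (fun x hx _ y hy hyW => norm_inner_ground_le hb N hself hsymm hg1 hg
      hcomm hγ hgap σ hσ hA hB hx hy hyW)
    (starProjection_mem_orthogonal_of_le (ground_anti b hIA) hv)
    (starProjection_mem_orthogonal_of_le (ground_anti b hIB) hv)
  -- The two gap bounds add up to `r (2‖v‖² - ‖P_A v‖² - ‖P_B v‖²)`, and `h1` bounds the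
  -- projections.
  have h2 := hgA.le_sum v
  have h3 := hgB.le_sum v
  have h4 := mul_le_mul_of_nonneg_left h1 hr
  linarith

/-- Divide and conquer: averaging over `s` cuts whose overlaps share no interaction term, the gap
`γ` of the full region is almost at least the gap `r` of the smaller regions. -/
theorem gap_le_of_cuts [DecidableEq κ] {b : κ → E →L[ℂ] E} (hb : ∀ i, ‖b i‖ ≤ 1)
    (N : κ → Finset κ) {I : Finset κ} (hself : ∀ i ∈ I, i ∈ N i)
    (hsymm : ∀ i ∈ I, ∀ j ∈ I, j ∈ N i → i ∈ N j) {g : ℕ} (hg1 : 1 ≤ g)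
    (hg : ∀ i ∈ I, (N i).card ≤ g)
    (hcomm : ∀ i ∈ I, ∀ j ∈ I, j ∉ N i → Commute (b i) (b j) ∧ Commute (b i) (star (b j)))
    {γ : ℝ} (hγ : 0 < γ) (hgap : HasGap b I γ)
    {v : E} (hv0 : v ≠ 0) (hv : v ∈ (ground b I)ᗮ) (hvγ : ∑ i ∈ I, ‖b i v‖ ^ 2 = γ * ‖v‖ ^ 2)
    (σ : κ → ℤ) (hσ : ∀ i ∈ I, ∀ j ∈ I, 2 ≤ σ j - σ i → j ∉ N i)
    {s n : ℕ} (hs : 1 ≤ s) (hn : 1 ≤ n) {IA IB : ℕ → Finset κ} {J : ℕ → ℤ}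
    (hIA : ∀ c, IA c ⊆ I) (hIB : ∀ c, IB c ⊆ I)
    (hA : ∀ c < s, ∀ i ∈ I, J c < σ i → i ∈ IA c)
    (hB : ∀ c < s, ∀ i ∈ I, σ i ≤ J c + 4 * n → i ∈ IB c)
    (hov : ∀ c c', ∀ i ∈ I, i ∈ IA c → i ∈ IB c → i ∈ IA c' → i ∈ IB c' → c = c')
    {r : ℝ} (hr : 0 ≤ r) (hgA : ∀ c < s, HasGap b (IA c) r) (hgB : ∀ c < s, HasGap b (IB c) r) :
    r ≤ (1 + 1 / (s : ℝ)) * (γ + (g : ℝ) ^ 2 / (2 * (n : ℝ) ^ 2)) := by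
  set z := 2 * (n : ℝ) ^ 2 * (γ / (g : ℝ) ^ 2) with hz
  have hg0 : (0 : ℝ) < g := by exact_mod_cast hg1
  have hs0 : (0 : ℝ) < s := by exact_mod_cast hs
  have hn0 : (0 : ℝ) < n := by exact_mod_cast hn
  have hz0 : 0 < z := by positivity
  have hvpos : 0 < ‖v‖ ^ 2 := by have := norm_pos_iff.mpr hv0; positivity
  have hlow : (s : ℝ) * (r * (1 - 1 / (1 + z)) * ‖v‖ ^ 2) ≤
      ∑ c ∈ Finset.range s, (∑ i ∈ IA c, ‖b i v‖ ^ 2 + ∑ i ∈ IB c, ‖b i v‖ ^ 2) := by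
    rw [← nsmul_eq_mul]
    conv_lhs => rw [← Finset.card_range s]
    refine Finset.card_nsmul_le_sum _ _ _ fun c hc => ?_
    have hc := Finset.mem_range.mp hc
    exact cut_energy_le hb N hself hsymm hg1 hg hcomm hγ.le hgap σ hσ (hIA c) (hIB c)
      (hA c hc) (hB c hc) hr (hgA c hc) (hgB c hc) hv
  -- Each term is counted once per cut, and a second time for at most one cut: at most `s + 1` times
  -- in all.
  have hup : ∑ c ∈ Finset.range s, (∑ i ∈ IA c, ‖b i v‖ ^ 2 + ∑ i ∈ IB c, ‖b i v‖ ^ 2) ≤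
      ((s : ℝ) + 1) * (γ * ‖v‖ ^ 2) := by
    have hrew : ∀ T : Finset κ, T ⊆ I →
        ∑ i ∈ T, ‖b i v‖ ^ 2 = ∑ i ∈ I, if i ∈ T then ‖b i v‖ ^ 2 else 0 := fun T hT => by
      rw [← Finset.sum_filter, Finset.filter_mem_eq_inter, Finset.inter_eq_right.mpr hT]
    rw [← hvγ, Finset.mul_sum]
    simp_rw [fun c => hrew _ (hIA c), fun c => hrew _ (hIB c), ← Finset.sum_add_distrib]
    rw [Finset.sum_comm]
    refine Finset.sum_le_sum fun i hi => ?_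
    have hcount : ((Finset.range s).filter fun c => i ∈ IA c ∧ i ∈ IB c).card ≤ 1 := by
      refine Finset.card_le_one.mpr fun c hc c' hc' => ?_
      simp only [Finset.mem_filter] at hc hc'
      exact hov c c' i hi hc.2.1 hc.2.2 hc'.2.1 hc'.2.2
    have hcount' : ∑ c ∈ Finset.range s, (if i ∈ IA c ∧ i ∈ IB c then ‖b i v‖ ^ 2 else 0) ≤
        ‖b i v‖ ^ 2 := by
      rw [← Finset.sum_filter, Finset.sum_const, nsmul_eq_mul]
      refine mul_le_of_le_one_left (by positivity) ?_
      exact_mod_cast hcount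
    calc _ ≤ ∑ c ∈ Finset.range s,
          (‖b i v‖ ^ 2 + if i ∈ IA c ∧ i ∈ IB c then ‖b i v‖ ^ 2 else 0) := by
          refine Finset.sum_le_sum fun c _ => ?_
          have := sq_nonneg ‖b i v‖
          by_cases h1 : i ∈ IA c <;> by_cases h2 : i ∈ IB c <;> simp [h1, h2]
      _ ≤ _ := by
          rw [Finset.sum_add_distrib, Finset.sum_const, Finset.card_range, nsmul_eq_mul, add_mul,
            one_mul]
          gcongr
  have h1 : (s : ℝ) * (r * (1 - 1 / (1 + z))) ≤ ((s : ℝ) + 1) * γ := by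
    refine le_of_mul_le_mul_right ?_ hvpos
    linarith
  have h2 : 1 - 1 / (1 + z) = z / (1 + z) := by field_simp; ring
  -- Here `γ / z = g² / (2 n²)`: dividing by `z / (1 + z)` turns the factor into an additive error
  -- free of `γ`.
  have h3 : γ + (g : ℝ) ^ 2 / (2 * (n : ℝ) ^ 2) = γ * (1 + z) / z := by
    rw [hz]; field_simp; ring
  have h4 : 1 + 1 / (s : ℝ) = ((s : ℝ) + 1) / s := by field_simp
  rw [h3, h4, div_mul_div_comm, le_div_iff₀ (by positivity)]
  rw [h2, mul_div_assoc', mul_div_assoc', div_le_iff₀ (by positivity)] at h1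
  linarith

end Cut

/-! ### Inclusions of local algebras. -/

section LocalAlgebra

variable {V : Type*} {d : ℕ} {X Y Z : Finset V}

theorem incl_apply (h : X ⊆ Y) (A : LocalAlg d X) (σ τ : Conf d Y)
    [Decidable (∀ i : Y, i.1 ∉ X → σ i = τ i)] :
    incl h A σ τ =
      if ∀ i : Y, i.1 ∉ X → σ i = τ i then A (restrictConf h σ) (restrictConf h τ) else 0 := by
  simp only [incl, Matrix.of_apply]
  congr

theorem incl_incl (h : X ⊆ Y) (h' : Y ⊆ Z) (A : LocalAlg d X) :
    incl h' (incl h A) = incl (h.trans h') A := by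
  classical
  ext σ τ
  rw [incl_apply, incl_apply, incl_apply, ← ite_and]
  refine if_congr ⟨?_, ?_⟩ rfl rfl
  · rintro ⟨h1, h2⟩ i hi
    by_cases hY : i.1 ∈ Y
    · exact h2 ⟨i.1, hY⟩ hi
    · exact h1 i hY
  · exact fun H => ⟨fun i hi => H i fun hX => hi (h hX), fun i hi => H ⟨i.1, h' i.2⟩ hi⟩

theorem incl_add (h : X ⊆ Y) (A B : LocalAlg d X) : incl h (A + B) = incl h A + incl h B := by
  classical
  ext σ τ
  simp only [Matrix.add_apply, incl_apply]
  split_ifs <;> simp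

theorem incl_smul (h : X ⊆ Y) (c : ℂ) (A : LocalAlg d X) : incl h (c • A) = c • incl h A := by
  classical
  ext σ τ
  simp only [Matrix.smul_apply, incl_apply]
  split_ifs <;> simp

theorem incl_star (h : X ⊆ Y) (A : LocalAlg d X) : incl h (star A) = star (incl h A) := by
  classical
  ext σ τ
  simp only [Matrix.star_apply, incl_apply]
  rw [apply_ite star, star_zero]
  exact if_congr (forall₂_congr fun _ _ => eq_comm) rfl rfl

theorem incl_one [DecidableEq V] (h : X ⊆ Y) : incl h (1 : LocalAlg d X) = 1 := by
  classical
  ext σ τ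
  rw [incl_apply, Matrix.one_apply, Matrix.one_apply, ← ite_and]
  refine if_congr ⟨?_, ?_⟩ rfl rfl
  · rintro ⟨h1, h2⟩
    ext1 i
    by_cases hX : i.1 ∈ X
    · exact congrFun h2 ⟨i.1, hX⟩
    · exact h1 i hX
  · rintro rfl
    exact ⟨fun _ _ => rfl, rfl⟩

theorem incl_mul [DecidableEq V] (h : X ⊆ Y) (A B : LocalAlg d X) :
    incl h (A * B) = incl h A * incl h B := by
  classical
  ext σ τ
  rw [incl_apply, Matrix.mul_apply, Matrix.mul_apply]
  simp_rw [incl_apply]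
  split_ifs with hστ
  · have : ∀ ρ : Conf d Y, ((if ∀ i : Y, i.1 ∉ X → σ i = ρ i then
        A (restrictConf h σ) (restrictConf h ρ) else 0) *
        if ∀ i : Y, i.1 ∉ X → ρ i = τ i then B (restrictConf h ρ) (restrictConf h τ) else 0) =
        if ∀ i : Y, i.1 ∉ X → σ i = ρ i then A (restrictConf h σ) (restrictConf h ρ) *
          B (restrictConf h ρ) (restrictConf h τ) else 0 := by
      intro ρ
      split_ifs with h1 h2 h2
      · rfl
      · exact absurd (fun i hi => (h1 i hi).symm.trans (hστ i hi)) h2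
      · simp
      · simp
    simp_rw [this]
    rw [← Finset.sum_filter]
    -- Intermediate configurations that agree with `σ` off `X` correspond to configurations on `X`.
    refine Finset.sum_bij' (fun ρ _ i => if hi : i.1 ∈ X then ρ ⟨i.1, hi⟩ else σ i)
      (fun ρ _ => restrictConf h ρ) ?_ ?_ ?_ ?_ ?_
    · intro ρ _
      simp only [Finset.mem_filter, Finset.mem_univ, true_and]
      intro i hi
      simp [hi]
    · simp
    · intro ρ _
      ext1 i
      simp [restrictConf]
    · intro ρ hρ
      simp only [Finset.mem_filter, Finset.mem_univ, true_and] at hρ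
      ext1 i
      by_cases hi : i.1 ∈ X
      · simp [hi, restrictConf]
      · simp [hi, hρ i hi]
    · intro ρ _
      have : restrictConf h (fun i => if hi : i.1 ∈ X then ρ ⟨i.1, hi⟩ else σ i) = ρ := by
        ext1 i
        simp [restrictConf]
      rw [this]
  · rw [Finset.sum_eq_zero]
    intro ρ _
    split_ifs with h1 h2 h2
    · exact absurd (fun i hi => (h1 i hi).trans (h2 i hi)) hστ
    all_goals simp

/-- The inclusion of local algebras as a homomorphism of star algebras. -/
noncomputable def inclHom [DecidableEq V] (h : X ⊆ Y) : LocalAlg d X →⋆ₐ[ℂ] LocalAlg d Y where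
  toFun := incl h
  map_one' := incl_one h
  map_mul' := incl_mul h
  map_zero' := by simpa using incl_smul h 0 (0 : LocalAlg d X)
  map_add' := incl_add h
  commutes' c := by rw [Algebra.algebraMap_eq_smul_one, incl_smul, incl_one,
    Algebra.algebraMap_eq_smul_one]
  map_star' := incl_star h

@[simp] theorem inclHom_apply [DecidableEq V] (h : X ⊆ Y) (A : LocalAlg d X) :
    inclHom h A = incl h A := rfl

theorem incl_mul_incl_apply [DecidableEq V] (h : X ⊆ Y) (h' : Z ⊆ Y) (hd : Disjoint X Z)
    (A : LocalAlg d X) (B : LocalAlg d Z) (σ τ : Conf d Y)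
    [Decidable (∀ i : Y, i.1 ∉ X → i.1 ∉ Z → σ i = τ i)] :
    (incl h A * incl h' B) σ τ = if ∀ i : Y, i.1 ∉ X → i.1 ∉ Z → σ i = τ i then
      A (restrictConf h σ) (restrictConf h τ) * B (restrictConf h' σ) (restrictConf h' τ)
      else 0 := by
  classical
  rw [Matrix.mul_apply]
  simp_rw [incl_apply]
  -- The only intermediate configuration that contributes: off `X` it must equal `σ`, and off `Z`,
  -- hence on `X`, it must equal `τ`.
  set ρ₀ : Conf d Y := fun i => if i.1 ∈ X then τ i else σ i with hρ₀
  have hXZ : ∀ i, i ∈ X → i ∉ Z := fun i hi hZ => Finset.disjoint_left.mp hd hi hZ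
  rw [Finset.sum_eq_single ρ₀]
  · have h1 : ∀ i : Y, i.1 ∉ X → σ i = ρ₀ i := fun i hi => by simp [hρ₀, hi]
    have h2 : restrictConf h ρ₀ = restrictConf h τ := by
      ext1 i
      simp [restrictConf, hρ₀]
    have h3 : restrictConf h' ρ₀ = restrictConf h' σ := by
      ext1 i
      have : i.1 ∉ X := fun hi => hXZ _ hi i.2
      simp [restrictConf, hρ₀, this]
    rw [if_pos h1, h2, h3, mul_ite, mul_zero]
    refine if_congr ⟨fun H i hX hZ => (h1 i hX).trans (H i hZ), fun H i hZ => ?_⟩ rfl rfl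
    by_cases hX : i.1 ∈ X
    · simp [hρ₀, hX]
    · rw [← h1 i hX]
      exact H i hX hZ
  · intro ρ _ hρ
    split_ifs with h1 h2 h2
    · refine absurd ?_ hρ
      ext1 i
      by_cases hX : i.1 ∈ X
      · simp [hρ₀, hX, h2 i (hXZ _ hX)]
      · simp [hρ₀, hX, h1 i hX]
    all_goals simp
  · simp

theorem commute_incl [DecidableEq V] (h : X ⊆ Y) (h' : Z ⊆ Y) (hd : Disjoint X Z)
    (A : LocalAlg d X) (B : LocalAlg d Z) : Commute (incl h A) (incl h' B) := by
  classical
  ext σ τ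
  rw [incl_mul_incl_apply h h' hd, incl_mul_incl_apply h' h hd.symm]
  exact if_congr ⟨fun H i h1 h2 => H i h2 h1, fun H i h1 h2 => H i h2 h1⟩ (mul_comm _ _) rfl

end LocalAlgebra

/-! ### The spectral gap and the quadratic form. -/

section Gap

variable {n : Type*} [Fintype n] [DecidableEq n] {A : Matrix n n ℂ}

theorem eigenvector_apply (hA : A.IsHermitian) (j : n) :
    Matrix.toEuclideanCLM (n := n) (𝕜 := ℂ) A (hA.eigenvectorBasis j) =
      (hA.eigenvalues j : ℂ) • hA.eigenvectorBasis j := by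
  apply (WithLp.ofLp_injective 2)
  rw [Matrix.ofLp_toEuclideanCLM, hA.mulVec_eigenvectorBasis]
  rfl

theorem gap_nonneg (hA : A.PosSemidef) : 0 ≤ gap A := by
  refine le_iInf₂ fun E hE => ?_
  rw [hA.1.spectrum_real_eq_range_eigenvalues] at hE
  obtain ⟨⟨j, rfl⟩, -⟩ := hE
  exact_mod_cast hA.eigenvalues_nonneg j

theorem gap_le_quadratic (hA : A.IsHermitian) {r : ℝ} (hr : (r : EReal) ≤ gap A)
    {v : EuclideanSpace ℂ n}
    (hv : ∀ u, Matrix.toEuclideanCLM (n := n) (𝕜 := ℂ) A u = 0 → inner ℂ u v = 0) :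
    r * ‖v‖ ^ 2 ≤ (inner ℂ v (Matrix.toEuclideanCLM (n := n) (𝕜 := ℂ) A v)).re := by
  set e := hA.eigenvectorBasis
  have hsum : inner ℂ v (Matrix.toEuclideanCLM (n := n) (𝕜 := ℂ) A v) =
      ∑ j, (hA.eigenvalues j : ℂ) * ((‖inner ℂ (e j) v‖ ^ 2 : ℝ) : ℂ) := by
    conv_lhs => rw [← e.sum_repr' v]
    conv_lhs => rw [map_sum, e.sum_repr' v, inner_sum]
    refine Finset.sum_congr rfl fun j _ => ?_
    rw [map_smul, eigenvector_apply, inner_smul_right, inner_smul_right, ← inner_conj_symm v,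
      mul_left_comm, RCLike.mul_conj]
    simp [e]
  rw [hsum, Complex.re_sum, ← e.sum_sq_norm_inner_right v, Finset.mul_sum]
  refine Finset.sum_le_sum fun j _ => ?_
  rw [← Complex.ofReal_mul, Complex.ofReal_re]
  by_cases hj : hA.eigenvalues j = 0
  · rw [hv (e j) (by rw [eigenvector_apply, hj]; simp)]
    simp
  · gcongr
    have : gap A ≤ (hA.eigenvalues j : EReal) :=
      iInf₂_le _ ⟨hA.spectrum_real_eq_range_eigenvalues ▸ Set.mem_range_self j, hj⟩
    exact_mod_cast hr.trans this

/-- The spectrum is finite, so the infimum is attained as soon as it is not over the empty set. -/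
theorem exists_eigenvector_of_gap (hA : A.PosSemidef) (h : gap A ≠ ⊤) :
    ∃ γ : ℝ, 0 < γ ∧ gap A = γ ∧ ∃ v : EuclideanSpace ℂ n, v ≠ 0 ∧
      Matrix.toEuclideanCLM (n := n) (𝕜 := ℂ) A v = (γ : ℂ) • v := by
  have hfin : (spectrum ℝ A \ {0}).Finite := by
    rw [hA.1.spectrum_real_eq_range_eigenvalues]
    exact (Set.finite_range _).subset Set.sdiff_subset
  have hne : (spectrum ℝ A \ {0}).Nonempty := by
    by_contra hempty
    rw [Set.not_nonempty_iff_eq_empty] at hempty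
    exact h (by simp [gap, hempty])
  obtain ⟨γ, hγ, hmin⟩ := Set.exists_min_image _ id hfin hne
  have hgap : gap A = γ := le_antisymm (iInf₂_le _ hγ)
    (le_iInf₂ fun E hE => by exact_mod_cast hmin E hE)
  obtain ⟨hspec, h0⟩ := hγ
  rw [hA.1.spectrum_real_eq_range_eigenvalues] at hspec
  obtain ⟨j, rfl⟩ := hspec
  exact ⟨_, lt_of_le_of_ne (hA.eigenvalues_nonneg j) (Ne.symm h0), hgap,
    hA.1.eigenvectorBasis j, hA.1.eigenvectorBasis.orthonormal.ne_zero j, eigenvector_apply _ j⟩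

end Gap

/-! ### Interaction terms as contractions on a common Hilbert space. -/

section LocalTerms

variable {V : Type*} [DecidableEq V] {d : ℕ}

/-- A unital homomorphism does not enlarge the spectrum. Gaps of subregions can thus be used on the
Hilbert space of the full region. -/
theorem gap_le_gap_incl {X Y : Finset V} (h : X ⊆ Y) (A : LocalAlg d X) :
    gap A ≤ gap (incl h A) :=
  biInf_mono fun _ hE =>
    ⟨AlgHom.spectrum_apply_subset ((inclHom h).toAlgHom.restrictScalars ℝ) A hE.1, hE.2⟩

theorem hamiltonian_incl (Φ : Interaction V d) {X Y : Finset V} (h : X ⊆ Y) :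
    incl h (hamiltonian Φ X) =
      ∑ Z ∈ X.powerset.attach, incl ((Finset.mem_powerset.mp Z.2).trans h) (Φ Z.1) := by
  rw [hamiltonian, ← inclHom_apply, map_sum]
  exact Finset.sum_congr rfl fun Z _ => incl_incl _ _ _

theorem exists_factor {n : Type*} [Fintype n] [DecidableEq n] {A : Matrix n n ℂ}
    (hA : A.PosSemidef) {M : ℝ} (hM0 : 0 < M)
    (hM : ‖Matrix.toEuclideanCLM (n := n) (𝕜 := ℂ) A‖ ≤ M) :
    ∃ B : Matrix n n ℂ, A = (M : ℂ) • (star B * B) ∧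
      ‖Matrix.toEuclideanCLM (n := n) (𝕜 := ℂ) B‖ ≤ 1 := by
  open scoped MatrixOrder Matrix.Norms.L2Operator in
  obtain ⟨B, hB⟩ := CStarAlgebra.nonneg_iff_eq_star_mul_self.mp
    (hA.smul (a := M⁻¹) (by positivity)).nonneg
  refine ⟨B, ?_, ?_⟩
  · rw [← hB, ← Complex.coe_smul, smul_smul, ← Complex.ofReal_mul,
      mul_inv_cancel₀ hM0.ne', Complex.ofReal_one, one_smul]
  · have h1 : ‖Matrix.toEuclideanCLM (n := n) (𝕜 := ℂ) B‖ *
        ‖Matrix.toEuclideanCLM (n := n) (𝕜 := ℂ) B‖ ≤ 1 := by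
      rw [← CStarRing.norm_star_mul_self, ← map_star, ← map_mul, ← hB, ← Complex.coe_smul, map_smul,
        norm_smul, Complex.norm_real, norm_inv, Real.norm_of_nonneg hM0.le,
        inv_mul_le_iff₀ hM0, mul_one]
      exact hM
    nlinarith [norm_nonneg (Matrix.toEuclideanCLM (n := n) (𝕜 := ℂ) B)]

/-- The representation of a local operator on the Hilbert space of a larger region. -/
noncomputable def localOp {X Y : Finset V} (h : X ⊆ Y) :
    LocalAlg d X →⋆ₐ[ℂ] (EuclideanSpace ℂ (Conf d Y) →L[ℂ] EuclideanSpace ℂ (Conf d Y)) :=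
  (Matrix.toEuclideanCLM (n := Conf d Y) (𝕜 := ℂ)).toStarAlgHom.comp (inclHom h)

theorem localOp_apply {X Y : Finset V} (h : X ⊆ Y) (A : LocalAlg d X) :
    localOp h A = Matrix.toEuclideanCLM (n := Conf d Y) (𝕜 := ℂ) (incl h A) := rfl

/-- Star homomorphisms of C⋆-algebras are contractive. -/
theorem norm_localOp_le {X Y : Finset V} (h : X ⊆ Y) (A : LocalAlg d X) :
    ‖localOp h A‖ ≤ ‖Matrix.toEuclideanCLM (n := Conf d X) (𝕜 := ℂ) A‖ := by
  have := NonUnitalStarAlgHom.norm_apply_le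
    ((localOp (d := d) h).comp (Matrix.toEuclideanCLM (n := Conf d X) (𝕜 := ℂ)).symm.toStarAlgHom)
    (Matrix.toEuclideanCLM (n := Conf d X) (𝕜 := ℂ) A)
  simpa using this

theorem posSemidef_incl {X Y : Finset V} (h : X ⊆ Y) {A : LocalAlg d X} (hA : A.PosSemidef) :
    (incl h A).PosSemidef := by
  open scoped MatrixOrder in
  obtain ⟨B, rfl⟩ := CStarAlgebra.nonneg_iff_eq_star_mul_self.mp hA.nonneg
  rw [incl_mul, incl_star]
  exact Matrix.posSemidef_conjTranspose_mul_self _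

theorem posSemidef_hamiltonian {Φ : Interaction V d} (hpos : ∀ X, (Φ X).PosSemidef)
    (Λ : Finset V) : (hamiltonian Φ Λ).PosSemidef :=
  Matrix.posSemidef_sum _ fun X _ => posSemidef_incl _ (hpos X.1)

open Classical in
/-- The regions inside `Λ` carrying a nonzero interaction term. -/
noncomputable def terms (Φ : Interaction V d) (Λ : Finset V) : Finset (Finset V) :=
  Λ.powerset.filter fun X => Φ X ≠ 0

theorem mem_terms {Φ : Interaction V d} {Λ X : Finset V} :
    X ∈ terms Φ Λ ↔ X ⊆ Λ ∧ Φ X ≠ 0 := by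
  simp [terms]

/-- The family of local operators `B X`, represented on the region `Λ`. -/
noncomputable def termOp (B : Interaction V d) (Λ X : Finset V) :
    EuclideanSpace ℂ (Conf d Λ) →L[ℂ] EuclideanSpace ℂ (Conf d Λ) :=
  -- The value 0 is a filler that makes the family total while keeping the norm bound.
  if h : X ⊆ Λ then localOp h (B X) else 0

theorem termOp_of_subset (B : Interaction V d) {Λ X : Finset V} (h : X ⊆ Λ) :
    termOp B Λ X = localOp h (B X) := dif_pos h

theorem norm_termOp_le {B : Interaction V d}
    (hB : ∀ X, ‖Matrix.toEuclideanCLM (n := Conf d X) (𝕜 := ℂ) (B X)‖ ≤ 1) (Λ X : Finset V) :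
    ‖termOp B Λ X‖ ≤ 1 := by
  unfold termOp
  split_ifs with h
  · exact (norm_localOp_le h _).trans (hB X)
  · simp

theorem commute_termOp (B : Interaction V d) {Λ X Y : Finset V} (hX : X ⊆ Λ) (hY : Y ⊆ Λ)
    (hd : Disjoint X Y) : Commute (termOp B Λ X) (termOp B Λ Y) ∧
      Commute (termOp B Λ X) (star (termOp B Λ Y)) := by
  rw [termOp_of_subset B hX, termOp_of_subset B hY, ← map_star, localOp_apply, localOp_apply,
    localOp_apply]
  exact ⟨(commute_incl hX hY hd _ _).map _, (commute_incl hX hY hd _ _).map _⟩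

theorem toEuclideanCLM_incl_hamiltonian {Φ B : Interaction V d} {M : ℝ}
    (hB : ∀ X, Φ X = (M : ℂ) • (star (B X) * B X)) {Λ' Λ : Finset V} (h : Λ' ⊆ Λ) :
    Matrix.toEuclideanCLM (n := Conf d Λ) (𝕜 := ℂ) (incl h (hamiltonian Φ Λ')) =
      (M : ℂ) • energy (termOp B Λ) (terms Φ Λ') := by
  have hterm : ∀ X ∈ Λ'.powerset, ∀ hX : X ⊆ Λ,
      localOp hX (Φ X) = (M : ℂ) • (star (termOp B Λ X) * termOp B Λ X) := fun X _ hX => by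
    rw [hB, map_smul, map_mul, map_star, termOp_of_subset B hX]
  rw [hamiltonian_incl, map_sum, energy, Finset.smul_sum]
  calc _ = ∑ X ∈ Λ'.powerset.attach,
        (M : ℂ) • (star (termOp B Λ X.1) * termOp B Λ X.1) :=
        Finset.sum_congr rfl fun X _ => hterm X.1 X.2 _
    _ = ∑ X ∈ Λ'.powerset, (M : ℂ) • (star (termOp B Λ X) * termOp B Λ X) :=
        Finset.sum_attach _ fun X => (M : ℂ) • (star (termOp B Λ X) * termOp B Λ X)
    _ = _ := by
        refine (Finset.sum_subset (fun X hX => ?_) fun X hX hX' => ?_).symm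
        · exact Finset.mem_powerset.mpr (mem_terms.mp hX).1
        · have hXΛ := Finset.mem_powerset.mp hX
          have : Φ X = 0 := by
            by_contra h0
            exact hX' (mem_terms.mpr ⟨hXΛ, h0⟩)
          rw [← hterm X hX (hXΛ.trans h), this, map_zero]

theorem hasGap_of_le_gap {Φ B : Interaction V d} (hpos : ∀ X, (Φ X).PosSemidef) {M : ℝ}
    (hM : 0 < M) (hB : ∀ X, Φ X = (M : ℂ) • (star (B X) * B X)) {Λ' Λ : Finset V} (h : Λ' ⊆ Λ)
    {r : ℝ} (hr : (r : EReal) ≤ gap (hamiltonian Φ Λ')) :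
    HasGap (termOp B Λ) (terms Φ Λ') (r / M) := by
  intro v hv
  have h1 := gap_le_quadratic (posSemidef_incl h (posSemidef_hamiltonian hpos Λ')).1
    (hr.trans (gap_le_gap_incl h _)) (v := v) fun u hu => by
      rw [toEuclideanCLM_incl_hamiltonian hB h] at hu
      refine Submodule.mem_orthogonal _ _ |>.mp hv u ?_
      exact (smul_eq_zero.mp hu).resolve_left (by exact_mod_cast hM.ne')
  rw [toEuclideanCLM_incl_hamiltonian hB h, smul_apply, inner_smul_right,
    Complex.re_ofReal_mul, re_inner_energy] at h1
  rw [div_mul_eq_mul_div, div_le_iff₀ hM]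
  linarith

theorem incl_self {X : Finset V} (h : X ⊆ X) (A : LocalAlg d X) : incl h A = A := by
  classical
  ext σ τ
  rw [incl_apply, if_pos fun i hi => absurd i.2 hi]
  rfl

/-- `H_∅` is a single number, with nonzero kernel only if it vanishes. Frustration-freeness thus
ensures that every nonzero term has a site, hence a position. -/
theorem apply_empty_eq_zero {Φ : Interaction V d} (hFF : FrustrationFree Φ) : Φ ∅ = 0 := by
  by_contra h
  refine hFF ∅ ?_
  have hH : hamiltonian Φ ∅ = Φ ∅ := by
    have hall : ∀ X ∈ (∅ : Finset V).powerset.attach,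
        incl (Finset.mem_powerset.mp X.2) (Φ X.1) = Φ ∅ := by
      rintro ⟨X, hX⟩ _
      obtain rfl := Finset.subset_empty.mp (Finset.mem_powerset.mp hX)
      exact incl_self _ _
    rw [hamiltonian, Finset.sum_congr rfl hall]
    simp
  rw [hH, LinearMap.ker_eq_bot']
  intro v hv
  have hval : Φ ∅ default default ≠ 0 := fun h0 => h (by
    ext σ τ
    rw [Subsingleton.elim σ default, Subsingleton.elim τ default, h0]
    rfl)
  have := congrFun hv default
  simp only [Matrix.mulVecLin_apply, Matrix.mulVec, dotProduct, Pi.zero_apply,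
    Fintype.sum_unique] at this
  ext σ
  rw [Subsingleton.elim σ default]
  exact (mul_eq_zero.mp this).resolve_left hval

end LocalTerms

/-! ### Counting neighbours and cutting along a coordinate. -/

section Geometry

variable {V : Type*} {D : ℕ} {G : SimpleGraph V} {C : ℝ} {ι : V → EuclideanSpace ℝ (Fin D)}

/-- The graph distance is an integer below 1, hence 0, and then the lower Lipschitz bound and
injectivity apply. -/
theorem IsBiLipschitzEmbedding.eq_of_norm_lt (hι : IsBiLipschitzEmbedding G C ι) (hC : 1 ≤ C)
    {i j : V} (h : ‖ι i - ι j‖ < C⁻¹) : i = j := by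
  have hC0 : 0 < C := by linarith
  obtain ⟨h1, h2⟩ := hι.2 i j
  have h3 : (G.dist i j : ℝ) < 1 := by
    calc (G.dist i j : ℝ) ≤ C * ‖ι i - ι j‖ := h2
      _ < C * C⁻¹ := by gcongr
      _ = 1 := mul_inv_cancel₀ hC0.ne'
  have h4 : G.dist i j = 0 := by exact_mod_cast Nat.lt_one_iff.mp (by exact_mod_cast h3)
  rw [h4, Nat.cast_zero] at h1
  have h5 : ‖ι i - ι j‖ ≤ 0 := by
    by_contra hpos
    push Not at hpos
    have : 0 < C⁻¹ * ‖ι i - ι j‖ := by positivity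
    linarith
  exact hι.1 (sub_eq_zero.mp (norm_le_zero_iff.mp h5))

/-- Cover the ball by finitely many balls of radius `1/(2C)`; each holds at most one vertex. -/
theorem IsBiLipschitzEmbedding.exists_card_le (hι : IsBiLipschitzEmbedding G C ι) (hC : 1 ≤ C)
    (ρ : ℝ) : ∃ N : ℕ, ∀ (i : V) (S : Finset V), (∀ j ∈ S, ‖ι j - ι i‖ ≤ ρ) → S.card ≤ N := by
  have hC0 : 0 < C := by linarith
  have htb := (isCompact_closedBall (0 : EuclideanSpace ℝ (Fin D)) ρ).totallyBounded
  obtain ⟨t, htfin, ht⟩ := Metric.totallyBounded_iff.mp htb (C⁻¹ / 2) (by positivity)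
  refine ⟨htfin.toFinset.card, fun i S hS => ?_⟩
  have hex : ∀ j ∈ S, ∃ y ∈ t, dist (ι j - ι i) y < C⁻¹ / 2 := fun j hj => by
    have := ht (show ι j - ι i ∈ Metric.closedBall 0 ρ by simpa using hS j hj)
    simpa using this
  choose! f hf hfd using hex
  refine Finset.card_le_card_of_injOn f (fun j hj => by simpa using hf j hj) ?_
  intro j hj k hk hjk
  refine hι.eq_of_norm_lt hC ?_
  have h1 := hfd j hj
  have h2 := hfd k hk
  rw [← hjk] at h2
  have h3 := dist_triangle_right (ι j - ι i) (ι k - ι i) (f j)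
  rw [dist_sub_right, dist_eq_norm] at h3
  linarith

variable {d : ℕ} {Φ : Interaction V d} {R : ℝ}

theorem norm_sub_le_of_term_ne_zero (hι : IsBiLipschitzEmbedding G C ι) (hC : 1 ≤ C)
    (hrange : HasRange G Φ R) {X : Finset V} (hX : Φ X ≠ 0) {i j : V} (hi : i ∈ X) (hj : j ∈ X) :
    ‖ι i - ι j‖ ≤ C * R := by
  have hC0 : 0 < C := by linarith
  have h1 := (hι.2 i j).1
  have h2 : (G.dist i j : ℝ) ≤ R := by
    by_contra h
    exact hX (hrange X ⟨i, hi, j, hj, not_le.mp h⟩)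
  rw [inv_mul_le_iff₀ hC0] at h1
  exact h1.trans (by gcongr)

variable [DecidableEq V]

open Classical in
/-- The interaction terms in `Λ` whose support meets `X`. -/
noncomputable def neighbours (Φ : Interaction V d) (Λ X : Finset V) : Finset (Finset V) :=
  (terms Φ Λ).filter fun Y => ¬ Disjoint X Y

theorem mem_neighbours {Λ X Y : Finset V} :
    Y ∈ neighbours Φ Λ X ↔ Y ∈ terms Φ Λ ∧ ¬ Disjoint X Y := by
  simp [neighbours]

/-- A term meeting `X` is supported within `2 C R` of a fixed site of `X`, on one of at most `2 ^ N`
sets. -/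
theorem exists_card_neighbours_le (hι : IsBiLipschitzEmbedding G C ι) (hC : 1 ≤ C)
    (hrange : HasRange G Φ R) (hΦ : Φ ∅ = 0) :
    ∃ g : ℕ, 1 ≤ g ∧ ∀ Λ, ∀ X ∈ terms Φ Λ, (neighbours Φ Λ X).card ≤ g := by
  obtain ⟨N, hN⟩ := hι.exists_card_le hC (C * R + C * R)
  refine ⟨2 ^ N, Nat.one_le_two_pow, fun Λ X hX => ?_⟩
  have hX0 := (mem_terms.mp hX).2
  obtain ⟨x, hx⟩ : X.Nonempty := Finset.nonempty_iff_ne_empty.mpr fun h => hX0 (h ▸ hΦ)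
  classical
  set S := Λ.filter fun j => ‖ι j - ι x‖ ≤ C * R + C * R with hS
  have hsub : neighbours Φ Λ X ⊆ S.powerset := by
    intro Y hY
    obtain ⟨hY, hXY⟩ := mem_neighbours.mp hY
    obtain ⟨hYΛ, hY0⟩ := mem_terms.mp hY
    obtain ⟨z, hzX, hzY⟩ := Finset.not_disjoint_iff.mp hXY
    refine Finset.mem_powerset.mpr fun j hj => Finset.mem_filter.mpr ⟨hYΛ hj, ?_⟩
    calc ‖ι j - ι x‖ ≤ ‖ι j - ι z‖ + ‖ι z - ι x‖ := norm_sub_le_norm_sub_add_norm_sub _ _ _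
      _ ≤ _ := add_le_add (norm_sub_le_of_term_ne_zero hι hC hrange hY0 hj hzY)
        (norm_sub_le_of_term_ne_zero hι hC hrange hX0 hzX hx)
  calc _ ≤ S.powerset.card := Finset.card_le_card hsub
    _ = 2 ^ S.card := Finset.card_powerset _
    _ ≤ 2 ^ N := Nat.pow_le_pow_right (by norm_num)
      (hN x S fun j hj => (Finset.mem_filter.mp hj).2)

/-- The index of the strip of width `w` containing a chosen site of `X`. -/
noncomputable def strip (c : V → ℝ) (w : ℝ) (X : Finset V) : ℤ :=
  open Classical in if h : X.Nonempty then ⌊c h.choose / w⌋ else 0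

omit [DecidableEq V] in
theorem exists_strip_eq (c : V → ℝ) (w : ℝ) {X : Finset V} (h : X.Nonempty) :
    ∃ x ∈ X, strip c w X = ⌊c x / w⌋ :=
  ⟨h.choose, h.choose_spec, dif_pos h⟩

theorem gap_region_le_of_cuts (hι : IsBiLipschitzEmbedding G C ι) (hC : 1 ≤ C) (hR : 0 < R)
    (hrange : HasRange G Φ R) (hΦ : Φ ∅ = 0) (hpos : ∀ X, (Φ X).PosSemidef) {M : ℝ} (hM : 0 < M)
    (hΦM : ∀ X, ‖Matrix.toEuclideanCLM (n := Conf d X) (𝕜 := ℂ) (Φ X)‖ ≤ M)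
    {g : ℕ} (hg1 : 1 ≤ g) (hg : ∀ Λ, ∀ X ∈ terms Φ Λ, (neighbours Φ Λ X).card ≤ g)
    (Λ : Finset V) {γ : ℝ} (hγ : gap (hamiltonian Φ Λ) = γ)
    {c : V → ℝ} (hc : ∀ i j, |c i - c j| ≤ ‖ι i - ι j‖)
    {s n : ℕ} (hs : 1 ≤ s) (hn : 1 ≤ n) {t : ℕ → ℝ}
    (ht : ∀ k, t k + (4 * n + 3) * (2 * (C * R)) ≤ t (k + 1)) {r : ℝ} (hr : 0 ≤ r)
    (hA : ∀ k < s, (r : EReal) ≤ gap (hamiltonian Φ (Λ.filter fun i => t k ≤ c i)))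
    (hB : ∀ k < s, (r : EReal) ≤ gap (hamiltonian Φ (Λ.filter fun i => c i < t (k + 1)))) :
    r ≤ (1 + 1 / (s : ℝ)) * (γ + M * (g : ℝ) ^ 2 / (2 * (n : ℝ) ^ 2)) := by
  choose B hB1 hB2 using fun X => exists_factor (hpos X) hM (hΦM X)
  -- Twice the bound on the diameter of a term: a term leaves its strip by at most `w / 2`, so terms
  -- two strips apart are disjoint.
  set w := 2 * (C * R) with hw
  have hw0 : 0 < w := by
    have : 0 < C := by linarith
    positivity
  have htmono : StrictMono t := strictMono_nat_of_lt_succ fun k => by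
    have : 0 < (4 * (n : ℝ) + 3) * w := by positivity
    linarith [ht k]
  have hne : ∀ X ∈ terms Φ Λ, X.Nonempty := fun X hX =>
    Finset.nonempty_iff_ne_empty.mpr fun h => (mem_terms.mp hX).2 (h ▸ hΦ)
  have hdiam : ∀ X ∈ terms Φ Λ, ∀ i ∈ X, ∀ j ∈ X, |c i - c j| ≤ w / 2 := fun X hX i hi j hj => by
    have := (hc i j).trans (norm_sub_le_of_term_ne_zero hι hC hrange (mem_terms.mp hX).2 hi hj)
    rw [hw]; linarith
  obtain ⟨γ', hγ0, hγ', v, hv0, hv⟩ :=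
    exists_eigenvector_of_gap (posSemidef_hamiltonian hpos Λ) (by simp [hγ])
  obtain rfl : γ' = γ := by exact_mod_cast hγ'.symm.trans hγ
  have henergy : Matrix.toEuclideanCLM (n := Conf d Λ) (𝕜 := ℂ) (hamiltonian Φ Λ) =
      (M : ℂ) • energy (termOp B Λ) (terms Φ Λ) := by
    rw [← toEuclideanCLM_incl_hamiltonian hB1 subset_rfl, incl_self]
  have hvE : energy (termOp B Λ) (terms Φ Λ) v = ((γ' / M : ℝ) : ℂ) • v := by
    rw [henergy, smul_apply] at hv
    have hMC : (M : ℂ) ≠ 0 := by exact_mod_cast hM.ne'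
    rw [← inv_smul_smul₀ hMC (energy _ _ v), hv, smul_smul]
    congr 1
    push_cast
    field_simp
  have hvorth : v ∈ (ground (termOp B Λ) (terms Φ Λ))ᗮ := by
    rw [Submodule.mem_orthogonal]
    intro u hu
    have h1 : inner ℂ u (energy (termOp B Λ) (terms Φ Λ) v) = 0 := by
      rw [energy, sum_apply, inner_sum]
      refine Finset.sum_eq_zero fun X hX => ?_
      rw [mul_apply_eq_comp, ContinuousLinearMap.star_eq_adjoint,
        ContinuousLinearMap.adjoint_inner_right, mem_ground.mp hu X hX, inner_zero_left]
    rw [hvE, inner_smul_right] at h1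
    refine (mul_eq_zero.mp h1).resolve_left ?_
    exact_mod_cast (div_pos hγ0 hM).ne'
  have hvγ : ∑ X ∈ terms Φ Λ, ‖termOp B Λ X v‖ ^ 2 = γ' / M * ‖v‖ ^ 2 := by
    rw [← re_inner_energy, hvE, inner_smul_right, Complex.re_ofReal_mul]
    congr 1
    exact inner_self_eq_norm_sq (𝕜 := ℂ) v
  have hgap : HasGap (termOp B Λ) (terms Φ Λ) (γ' / M) :=
    hasGap_of_le_gap hpos hM hB1 subset_rfl hγ.ge
  have hsub : ∀ {Λ'}, Λ' ⊆ Λ → terms Φ Λ' ⊆ terms Φ Λ := fun h X hX =>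
    mem_terms.mpr ⟨(mem_terms.mp hX).1.trans h, (mem_terms.mp hX).2⟩
  have hstrip : ∀ X ∈ terms Φ Λ, ∀ i ∈ X,
      (strip c w X - 1 / 2) * w ≤ c i ∧ c i < (strip c w X + 3 / 2) * w := by
    intro X hX i hi
    obtain ⟨x, hx, hsx⟩ := exists_strip_eq c w (hne X hX)
    have h1 := Int.floor_le (c x / w)
    have h2 := Int.lt_floor_add_one (c x / w)
    rw [← hsx] at h1 h2
    rw [le_div_iff₀ hw0] at h1
    rw [div_lt_iff₀ hw0] at h2
    have h3 := abs_le.mp (hdiam X hX i hi x hx)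
    constructor <;> linarith
  have key := gap_le_of_cuts (norm_termOp_le hB2 Λ) (neighbours Φ Λ) (I := terms Φ Λ)
    (fun X hX => mem_neighbours.mpr ⟨hX, by
      rw [disjoint_self]
      exact (hne X hX).ne_empty⟩)
    (fun X hX Y hY h => mem_neighbours.mpr ⟨hX, fun hd => (mem_neighbours.mp h).2 hd.symm⟩)
    hg1 (hg Λ)
    (fun X hX Y hY h => commute_termOp B (mem_terms.mp hX).1 (mem_terms.mp hY).1
      (by by_contra hd; exact h (mem_neighbours.mpr ⟨hY, hd⟩)))
    (div_pos hγ0 hM) hgap hv0 hvorth hvγ (strip c w) ?_ hs hn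
    (IA := fun k => terms Φ (Λ.filter fun i => t k ≤ c i))
    (IB := fun k => terms Φ (Λ.filter fun i => c i < t (k + 1)))
    -- The width `4 n + 3` in `ht` pays for `4 n` strips, at most 1 for this rounding and `3/2` for
    -- the extent of a term beyond the left edge of its strip.
    (J := fun k => ⌈t k / w⌉) (fun k => hsub (Finset.filter_subset _ _))
    (fun k => hsub (Finset.filter_subset _ _)) ?_ ?_ ?_ (div_nonneg hr hM.le)
    (fun k hk => hasGap_of_le_gap hpos hM hB1 (Finset.filter_subset _ _) (hA k hk))
    (fun k hk => hasGap_of_le_gap hpos hM hB1 (Finset.filter_subset _ _) (hB k hk))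
  · rw [div_le_iff₀ hM] at key
    refine key.trans (le_of_eq ?_)
    have hn0 : (0 : ℝ) < n := by exact_mod_cast hn
    have hs0 : (0 : ℝ) < s := by exact_mod_cast hs
    field_simp
  · intro X hX Y hY h hN
    obtain ⟨z, hzX, hzY⟩ := Finset.not_disjoint_iff.mp (mem_neighbours.mp hN).2
    have h1 := (hstrip X hX z hzX).2
    have h2 := (hstrip Y hY z hzY).1
    have h3 : (2 : ℝ) ≤ strip c w Y - strip c w X := by exact_mod_cast h
    nlinarith
  · intro k _ X hX h
    refine mem_terms.mpr ⟨fun i hi => Finset.mem_filter.mpr ⟨(mem_terms.mp hX).1 hi, ?_⟩,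
      (mem_terms.mp hX).2⟩
    have h1 := (hstrip X hX i hi).1
    have h2 := Int.le_ceil (t k / w)
    rw [div_le_iff₀ hw0] at h2
    have h3 : ((⌈t k / w⌉ : ℤ) : ℝ) + 1 ≤ strip c w X := by exact_mod_cast h
    nlinarith
  · intro k _ X hX h
    refine mem_terms.mpr ⟨fun i hi => Finset.mem_filter.mpr ⟨(mem_terms.mp hX).1 hi, ?_⟩,
      (mem_terms.mp hX).2⟩
    have h1 := (hstrip X hX i hi).2
    have h2 := Int.ceil_lt_add_one (t k / w)
    have h3 : (strip c w X : ℝ) ≤ (⌈t k / w⌉ : ℤ) + 4 * n := by exact_mod_cast h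
    have h4 : (strip c w X + 3 / 2) * w < (t k / w + (4 * n + 3)) * w :=
      mul_lt_mul_of_pos_right (by linarith) hw0
    have h5 : (t k / w + (4 * (n : ℝ) + 3)) * w = t k + (4 * n + 3) * w := by
      field_simp
    linarith [ht k]
  · intro k k' X hX h1 h2 h3 h4
    obtain ⟨x, hx⟩ := hne X hX
    have e1 := (Finset.mem_filter.mp ((mem_terms.mp h1).1 hx)).2
    have e2 := (Finset.mem_filter.mp ((mem_terms.mp h2).1 hx)).2
    have e3 := (Finset.mem_filter.mp ((mem_terms.mp h3).1 hx)).2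
    have e4 := (Finset.mem_filter.mp ((mem_terms.mp h4).1 hx)).2
    have l1 := htmono.lt_iff_lt.mp (e1.trans_lt e4)
    have l2 := htmono.lt_iff_lt.mp (e3.trans_lt e2)
    omega

end Geometry

/-! ### Rectangles and the recursion between scales. -/

section Rectangles

theorem len_eq_pow (D k : ℕ) : len D k = ((3 / 2 : ℝ) ^ (1 / (D : ℝ))) ^ k := by
  rw [len, ← Real.rpow_natCast, ← Real.rpow_mul (by norm_num)]
  congr 1
  ring

theorem len_pos (D k : ℕ) : 0 < len D k := by unfold len; positivity

theorem len_mono (D : ℕ) {k m : ℕ} (h : k ≤ m) : len D k ≤ len D m := by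
  unfold len
  gcongr
  norm_num

theorem len_add_dim {D : ℕ} (hD : 1 ≤ D) (k : ℕ) : len D (k + D) = 3 / 2 * len D k := by
  have : (D : ℝ) ≠ 0 := by positivity
  unfold len
  rw [Nat.cast_add, add_div, div_self this, Real.rpow_add (by norm_num), Real.rpow_one, mul_comm]

variable {V : Type*} {D : ℕ} {ι : V → EuclideanSpace ℝ (Fin D)}

theorem family_mono (k : ℕ) : family ι k ⊆ family ι (k + 1) := by
  rintro Λ ⟨a, π, h⟩
  exact ⟨a, π, fun i hi j => ⟨(h i hi j).1, (h i hi j).2.trans (len_mono D (by omega))⟩⟩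

/-- A member of `F_{k+1}` has a coordinate of range `3/2 l_{k+1}`, such that any piece whose range
in this coordinate is at most `l_{k+1}` belongs to `F_k`. -/
theorem exists_long_coordinate {m : ℕ} {ι : V → EuclideanSpace ℝ (Fin (m + 1))} {k : ℕ}
    {Λ : Finset V} (hΛ : Λ ∈ family ι (k + 1)) :
    ∃ c : V → ℝ, (∀ i j, |c i - c j| ≤ ‖ι i - ι j‖) ∧
      (∀ i ∈ Λ, 0 ≤ c i ∧ c i ≤ 3 / 2 * len (m + 1) (k + 1)) ∧
      ∀ (u : ℝ) (Λ' : Finset V), Λ' ⊆ Λ →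
        (∀ i ∈ Λ', u ≤ c i ∧ c i ≤ u + len (m + 1) (k + 1)) → Λ' ∈ family ι k := by
  obtain ⟨a, π, h⟩ := hΛ
  set p := π (Fin.last m) with hp
  refine ⟨fun i => (ι i - a) p, fun i j => ?_, fun i hi => ?_, fun u Λ' hsub hu => ?_⟩
  · have h1 : (ι i - a) p - (ι j - a) p = (ι i - ι j) p := by simp
    rw [h1]
    exact PiLp.norm_apply_le (ι i - ι j) p
  · have := h i hi (Fin.last m)
    rw [← len_add_dim (by omega)]
    exact this
  · refine ⟨a + EuclideanSpace.single p u, (finRotate (m + 1)).symm.trans π, fun i hi j => ?_⟩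
    refine Fin.cases ?_ (fun j => ?_) j
    · have h0 : (finRotate (m + 1)).symm 0 = Fin.last m := by
        rw [Equiv.symm_apply_eq, finRotate_last]
      have h1 := hu i hi
      simp only [Equiv.trans_apply, h0, ← hp]
      have h2 : (ι i - (a + EuclideanSpace.single p u)) p = (ι i - a) p - u := by
        simp; ring
      rw [h2]
      have h3 : k + (((0 : Fin (m + 1)) : ℕ) + 1) = k + 1 := by simp
      rw [h3]
      constructor <;> linarith
    · have h0 : (finRotate (m + 1)).symm j.succ = j.castSucc := by
        rw [Equiv.symm_apply_eq, finRotate_apply, Fin.coeSucc_eq_succ]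
      have h1 := h i (hsub hi) j.castSucc
      have hne : π j.castSucc ≠ p := fun he =>
        (Fin.castSucc_lt_last j).ne (π.injective he)
      simp only [Equiv.trans_apply, h0]
      have h2 : (ι i - (a + EuclideanSpace.single p u)) (π j.castSucc) =
          (ι i - a) (π j.castSucc) := by
        simp [hne]
      rw [h2]
      have h3 : k + ((j.succ : ℕ) + 1) = k + 1 + ((j.castSucc : ℕ) + 1) := by
        simp; ring
      rw [h3]
      exact h1

variable [DecidableEq V] {d : ℕ} {Φ : Interaction V d} {G : SimpleGraph V} {C R : ℝ}

theorem gapFamily_anti (Φ : Interaction V d) (ι : V → EuclideanSpace ℝ (Fin D)) :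
    Antitone (gapFamily Φ ι) :=
  antitone_nat_of_succ_le fun k => biInf_mono (family_mono k)

theorem gapFamily_nonneg (hpos : ∀ X, (Φ X).PosSemidef) (k : ℕ) : 0 ≤ gapFamily Φ ι k :=
  le_iInf₂ fun Λ _ => gap_nonneg (posSemidef_hamiltonian hpos Λ)

theorem exists_gapFamily_recursion (hD : 1 ≤ D) (hι : IsBiLipschitzEmbedding G C ι) (hC : 1 ≤ C)
    (hR : 0 < R) (hrange : HasRange G Φ R) (hΦ : Φ ∅ = 0) (hpos : ∀ X, (Φ X).PosSemidef)
    (hmax : phiMax Φ < ⊤) :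
    ∃ K : ℝ, 0 < K ∧ ∀ (k s n : ℕ) (r : ℝ), 1 ≤ s → 1 ≤ n →
      (4 * n + 3) * (2 * (C * R)) ≤ len D (k + 1) / (2 * s) →
      0 ≤ r → (r : EReal) ≤ gapFamily Φ ι k →
      ((r / (1 + 1 / (s : ℝ)) - K / (n : ℝ) ^ 2 : ℝ) : EReal) ≤ gapFamily Φ ι (k + 1) := by
  obtain ⟨m, rfl⟩ : ∃ m, D = m + 1 := ⟨D - 1, by omega⟩
  obtain ⟨g, hg1, hg⟩ := exists_card_neighbours_le hι hC hrange hΦ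
  -- The maximum with 1 keeps `M` positive even if all terms vanish.
  set M := max (phiMax Φ).toReal 1
  have hM : 0 < M := lt_max_of_lt_right one_pos
  have hΦM : ∀ X, ‖Matrix.toEuclideanCLM (n := Conf d X) (𝕜 := ℂ) (Φ X)‖ ≤ M := fun X => by
    refine le_max_of_le_left ?_
    rw [← toReal_enorm]
    exact ENNReal.toReal_mono hmax.ne
      (le_iSup (fun X => ‖Matrix.toEuclideanCLM (n := Conf d X) (𝕜 := ℂ) (Φ X)‖ₑ) X)
  refine ⟨M * (g : ℝ) ^ 2 / 2, by positivity, fun k s n r hs hn hwidth hr hrk => ?_⟩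
  refine le_iInf₂ fun Λ hΛ => ?_
  by_cases htop : gap (hamiltonian Φ Λ) = ⊤
  · simp [htop]
  obtain ⟨γ, -, hγ, -⟩ := exists_eigenvector_of_gap (posSemidef_hamiltonian hpos Λ) htop
  obtain ⟨c, hcι, hcΛ, hsub⟩ := exists_long_coordinate hΛ
  set l := len (m + 1) (k + 1)
  have hl : 0 < l := len_pos _ _
  have hs0 : (0 : ℝ) < s := by exact_mod_cast hs
  have hrΛ : ∀ Λ' ∈ family ι k, (r : EReal) ≤ gap (hamiltonian Φ Λ') := fun Λ' h =>
    hrk.trans (iInf₂_le _ h)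
  have key := gap_region_le_of_cuts hι hC hR hrange hΦ hpos hM hΦM hg1 hg Λ hγ hcι hs hn
    -- The middle third `[l/2, l]` of the long side is divided into `s` slabs, the overlaps. Either
    -- piece of each cut then has length at most `l`.
    (t := fun j => l / 2 + j * (l / (2 * s))) (fun j => by push_cast; linarith) hr ?_ ?_
  · have h1 : r / (1 + 1 / (s : ℝ)) ≤ γ + M * (g : ℝ) ^ 2 / (2 * (n : ℝ) ^ 2) := by
      rw [div_le_iff₀ (by positivity)]
      linarith
    rw [hγ]
    rw [← div_div] at h1
    exact_mod_cast (by linarith : r / (1 + 1 / (s : ℝ)) - M * (g : ℝ) ^ 2 / 2 / (n : ℝ) ^ 2 ≤ γ)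
  · refine fun j _ => hrΛ _ (hsub (l / 2) _ (Finset.filter_subset _ _) fun i hi => ?_)
    obtain ⟨hiΛ, hi⟩ := Finset.mem_filter.mp hi
    have h1 : 0 ≤ (j : ℝ) * (l / (2 * s)) := by positivity
    have := (hcΛ i hiΛ).2
    constructor <;> linarith
  · refine fun j hj => hrΛ _ (hsub 0 _ (Finset.filter_subset _ _) fun i hi => ?_)
    obtain ⟨hiΛ, hi⟩ := Finset.mem_filter.mp hi
    have h1 : ((j + 1 : ℕ) : ℝ) * (l / (2 * s)) ≤ s * (l / (2 * s)) := by
      gcongr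
      exact_mod_cast hj
    have h2 : (s : ℝ) * (l / (2 * s)) = l / 2 := by field_simp
    have := (hcΛ i hiΛ).1
    constructor <;> linarith

end Rectangles

/-! ### Solving the recursion from infinity. -/

section Recursion

/-- The weight `1 - 1/k` absorbs the factors `1 + 1/(k+1)²`, and the differences of `f k = B k⁴ /
q^k` absorb the errors, so `(1 - 1/k) u k - f k` is eventually nondecreasing. A positive value would
bound `u` away from 0. -/
theorem exists_decay_of_recursion {u : ℕ → ℝ} (hu : ∀ k, 0 ≤ u k) {q K : ℝ} (hq : 1 < q)
    (hK : 0 < K) (hsmall : ∀ c > 0, ∀ k, ∃ m ≥ k, u m < c)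
    (hrec : ∀ᶠ k : ℕ in atTop, u k ≤ (1 + 1 / ((k : ℝ) + 1) ^ 2) *
      (u (k + 1) + K * ((k : ℝ) + 1) ^ 4 / q ^ (k + 1))) :
    ∃ B : ℝ, ∀ᶠ k : ℕ in atTop, u k ≤ B * ((k : ℝ) ^ 4 / q ^ k) := by
  set B := 2 * K / (q - 1) with hB
  have hq1 : 0 < q - 1 := by linarith
  have hB0 : 0 < B := by positivity
  -- Equivalently `q k⁴ - (k+1)⁴ ≥ (q-1)/2 · (k+1)⁴`; `B` is chosen so that `B (q-1)/2 = K`.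
  have hratio : ∀ᶠ k : ℕ in atTop, ((k : ℝ) + 1) ^ 4 * (1 + (q - 1) / 2) ≤ q * (k : ℝ) ^ 4 := by
    have hlim : Tendsto (fun k : ℕ => (1 + 1 / (k : ℝ)) ^ 4 * (1 + (q - 1) / 2)) atTop
        (nhds ((1 + 0) ^ 4 * (1 + (q - 1) / 2))) :=
      ((tendsto_const_nhds.add tendsto_one_div_atTop_nhds_zero_nat).pow 4).mul_const _
    filter_upwards [hlim.eventually (gt_mem_nhds (show _ < q by linarith)),
      eventually_gt_atTop 0] with k hk hk0
    have hk0 : (0 : ℝ) < k := by exact_mod_cast hk0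
    have : ((k : ℝ) + 1) ^ 4 = (1 + 1 / (k : ℝ)) ^ 4 * (k : ℝ) ^ 4 := by
      rw [← mul_pow]; congr 1; field_simp
    rw [this]
    calc _ = (1 + 1 / (k : ℝ)) ^ 4 * (1 + (q - 1) / 2) * (k : ℝ) ^ 4 := by ring
      _ ≤ _ := by gcongr
  obtain ⟨k₀, hk₀⟩ := eventually_atTop.mp (hratio.and hrec)
  set f : ℕ → ℝ := fun k => B * ((k : ℝ) ^ 4 / q ^ k) with hf
  have hstep : ∀ k ≥ max k₀ 2, (1 - 1 / (k : ℝ)) * u k - f k ≤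
      (1 - 1 / ((k + 1 : ℕ) : ℝ)) * u (k + 1) - f (k + 1) := by
    intro k hk
    obtain ⟨h1, h2⟩ := hk₀ k (le_of_max_le_left hk)
    have hk2 : (2 : ℝ) ≤ k := by exact_mod_cast le_of_max_le_right hk
    have hqk : 0 < q ^ k := by positivity
    set e := K * ((k : ℝ) + 1) ^ 4 / q ^ (k + 1) with he
    have he0 : 0 ≤ e := by positivity
    have hfe : e ≤ f k - f (k + 1) := by
      have hf' : f k - f (k + 1) = B * (q * (k : ℝ) ^ 4 - ((k : ℝ) + 1) ^ 4) / q ^ (k + 1) := by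
        simp only [hf]
        push_cast
        field_simp
        ring
      have hKB : K = B * ((q - 1) / 2) := by rw [hB]; field_simp
      have h3 : K * ((k : ℝ) + 1) ^ 4 ≤ B * (q * (k : ℝ) ^ 4 - ((k : ℝ) + 1) ^ 4) := by
        rw [hKB, mul_assoc]
        exact mul_le_mul_of_nonneg_left (by linarith) hB0.le
      rw [hf', he]
      gcongr
    have hp : (1 - 1 / (k : ℝ)) * (1 + 1 / ((k : ℝ) + 1) ^ 2) ≤ 1 - 1 / ((k : ℝ) + 1) := by
      have hk0 : (0 : ℝ) < k := by linarith
      have : 1 - 1 / ((k : ℝ) + 1) - (1 - 1 / (k : ℝ)) * (1 + 1 / ((k : ℝ) + 1) ^ 2) =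
          2 / (k * ((k : ℝ) + 1) ^ 2) := by
        field_simp
        ring
      have h0 : 0 < 2 / (k * ((k : ℝ) + 1) ^ 2) := by positivity
      linarith
    have hp0 : 0 ≤ 1 - 1 / (k : ℝ) := by
      rw [sub_nonneg, div_le_one (by linarith)]
      linarith
    have hp1 : 1 - 1 / ((k : ℝ) + 1) ≤ 1 := by
      have : 0 < 1 / ((k : ℝ) + 1) := by positivity
      linarith
    have h3 : (1 - 1 / (k : ℝ)) * u k ≤ (1 - 1 / ((k : ℝ) + 1)) * (u (k + 1) + e) := by
      calc _ ≤ (1 - 1 / (k : ℝ)) * ((1 + 1 / ((k : ℝ) + 1) ^ 2) * (u (k + 1) + e)) := by gcongr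
        _ = (1 - 1 / (k : ℝ)) * (1 + 1 / ((k : ℝ) + 1) ^ 2) * (u (k + 1) + e) := by ring
        _ ≤ _ := by
          gcongr
          exact add_nonneg (hu _) he0
    have h4 : (1 - 1 / ((k : ℝ) + 1)) * e ≤ e := mul_le_of_le_one_left he0 hp1
    push_cast
    linarith
  -- The factor 2 undoes the weight, which is at least `1/2` for `k ≥ 2`.
  refine ⟨2 * B, eventually_atTop.mpr ⟨max k₀ 2, fun k hk => ?_⟩⟩
  have hle : (1 - 1 / (k : ℝ)) * u k ≤ f k := by
    by_contra hlt
    push Not at hlt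
    have hmono : ∀ m ≥ k, (1 - 1 / (k : ℝ)) * u k - f k ≤ (1 - 1 / (m : ℝ)) * u m - f m := by
      intro m hm
      induction m, hm using Nat.le_induction with
      | base => exact le_rfl
      | succ m hm ih => exact ih.trans (hstep m (hk.trans hm))
    obtain ⟨m, hm, hum⟩ := hsmall _ (sub_pos.mpr hlt) k
    have hmono := hmono m hm
    have hfm : 0 ≤ f m := by simp only [hf]; positivity
    have : (1 - 1 / (m : ℝ)) * u m ≤ u m := by
      refine mul_le_of_le_one_left (hu m) ?_
      have : 0 ≤ 1 / (m : ℝ) := by positivity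
      linarith
    linarith
  have hk2 : (2 : ℝ) ≤ k := by exact_mod_cast le_of_max_le_right hk
  have hhalf : 1 / 2 ≤ 1 - 1 / (k : ℝ) := by
    have : 1 / (k : ℝ) ≤ 1 / 2 := by gcongr
    linarith
  have : 1 / 2 * u k ≤ f k := le_trans (mul_le_mul_of_nonneg_right hhalf (hu k)) hle
  simp only [hf] at this
  linarith

end Recursion

/-! ### Choice of the number of cuts and of the overlap width. -/

section Scaling

variable {V : Type*} [DecidableEq V] {G : SimpleGraph V} {D : ℕ} {C R : ℝ}
  {ι : V → EuclideanSpace ℝ (Fin D)} {d : ℕ} {Φ : Interaction V d}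

theorem one_lt_len_base (hD : 1 ≤ D) : 1 < (3 / 2 : ℝ) ^ (1 / (D : ℝ)) :=
  Real.one_lt_rpow (by norm_num) (by positivity)

theorem len_sq (D k : ℕ) : len D k ^ 2 = (((3 / 2 : ℝ) ^ (1 / (D : ℝ))) ^ 2) ^ k := by
  rw [len_eq_pow, ← pow_mul, ← pow_mul, mul_comm]

theorem exists_overlap_width (hD : 1 ≤ D) {w : ℝ} (hw : 0 < w) :
    ∀ᶠ k : ℕ in atTop, ∃ n : ℕ, 1 ≤ n ∧
      (4 * n + 3) * w ≤ len D (k + 1) / (2 * ((k + 1) ^ 2 : ℕ)) ∧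
      1 / (n : ℝ) ^ 2 ≤ 256 * w ^ 2 * ((k : ℝ) + 1) ^ 4 / len D (k + 1) ^ 2 := by
  have hlim := (tendsto_pow_const_div_const_pow_of_one_lt 2 (one_lt_len_base hD)).comp
    (tendsto_add_atTop_nat 1)
  filter_upwards [hlim.eventually (gt_mem_nhds (show (0 : ℝ) < 1 / (28 * w) by positivity))]
    with k hk
  have hl := len_pos D (k + 1)
  simp only [Function.comp_apply, ← len_eq_pow] at hk
  push_cast at hk ⊢
  set l := len D (k + 1)
  have hk0 : 0 < ((k : ℝ) + 1) ^ 2 := by positivity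
  -- `L` is the slab width in units of `w`. With `n = ⌈L/8⌉`, `4 n + 3 ≤ L/2 + 7`, which is at most
  -- `L` once `L ≥ 14`; and `1/n² ≤ 64/L²` gives the constant 256.
  set L := l / (2 * ((k : ℝ) + 1) ^ 2 * w) with hL
  have hL14 : 14 ≤ L := by
    rw [hL, le_div_iff₀ (by positivity)]
    rw [div_lt_div_iff₀ hl (by positivity)] at hk
    linarith
  have hLw : l / (2 * ((k : ℝ) + 1) ^ 2) = L * w := by rw [hL]; field_simp
  have hn1 := Nat.le_ceil (L / 8)
  have hn2 := Nat.ceil_lt_add_one (show 0 ≤ L / 8 by positivity)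
  have hn0 : 0 < ⌈L / 8⌉₊ := Nat.ceil_pos.mpr (by positivity)
  refine ⟨⌈L / 8⌉₊, hn0, ?_, ?_⟩
  · rw [hLw]
    gcongr
    linarith
  · calc 1 / (⌈L / 8⌉₊ : ℝ) ^ 2 ≤ 1 / (L / 8) ^ 2 := by gcongr
      _ = _ := by rw [hL]; field_simp; ring

theorem exists_gapFamily_bound (hD : 1 ≤ D) (hι : IsBiLipschitzEmbedding G C ι) (hC : 1 ≤ C)
    (hR : 0 < R) (hrange : HasRange G Φ R) (hΦ : Φ ∅ = 0) (hpos : ∀ X, (Φ X).PosSemidef)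
    (hmax : phiMax Φ < ⊤) (hgap : gapInfinite Φ ι = 0)
    (hfin : ∀ᶠ k : ℕ in atTop, gapFamily Φ ι k ≠ ⊤ ∧ gapFamily Φ ι k ≠ ⊥) :
    ∃ B : ℝ, ∀ᶠ k : ℕ in atTop, (gapFamily Φ ι k).toReal ≤ B * ((k : ℝ) ^ 4 / len D k ^ 2) := by
  obtain ⟨K, hK, hrec⟩ := exists_gapFamily_recursion hD hι hC hR hrange hΦ hpos hmax
  have hw : 0 < 2 * (C * R) := by
    have : 0 < C := by linarith
    positivity
  simp_rw [len_sq]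
  refine exists_decay_of_recursion (fun k => EReal.toReal_nonneg (gapFamily_nonneg hpos k))
    (one_lt_pow₀ (one_lt_len_base hD) two_ne_zero)
    (K := K * (256 * (2 * (C * R)) ^ 2)) (by positivity) ?_ ?_
  · intro c hc k
    obtain ⟨k₁, hk₁⟩ := eventually_atTop.mp hfin
    by_contra hno
    push Not at hno
    have hle : ∀ j, (c : EReal) ≤ gapFamily Φ ι j := fun j => by
      set m := max j (max k k₁)
      have hm := hno m ((le_max_left _ _).trans (le_max_right _ _))
      obtain ⟨h1, h2⟩ := hk₁ m ((le_max_right _ _).trans (le_max_right _ _))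
      refine le_trans ?_ (gapFamily_anti Φ ι (le_max_left j (max k k₁)))
      rw [← EReal.coe_toReal h1 h2]
      exact_mod_cast hm
    have : (c : EReal) ≤ gapInfinite Φ ι := le_iInf₂ fun j _ => hle j
    rw [hgap] at this
    have : c ≤ 0 := by exact_mod_cast this
    linarith
  · filter_upwards [exists_overlap_width hD hw, hfin, (tendsto_add_atTop_nat 1).eventually hfin]
      with k ⟨n, hn, hwidth, hn2⟩ ⟨h1, h2⟩ ⟨h3, h4⟩
    set r := (gapFamily Φ ι k).toReal with hr
    have hr0 : 0 ≤ r := EReal.toReal_nonneg (gapFamily_nonneg hpos k)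
    -- The choice `s = (k+1)²` makes `1/s` summable, at the price of the factor `(k+1)⁴` in `1/n²`.
    have key := hrec k ((k + 1) ^ 2) n r (Nat.one_le_pow _ _ (by omega)) hn hwidth hr0
      (EReal.coe_toReal h1 h2).le
    rw [← EReal.coe_toReal h3 h4, EReal.coe_le_coe_iff] at key
    push_cast at key
    have hden : 0 < 1 + 1 / ((k : ℝ) + 1) ^ 2 := by positivity
    rw [sub_le_iff_le_add, div_le_iff₀ hden, mul_comm] at key
    refine key.trans ?_
    rw [← len_sq]
    refine mul_le_mul_of_nonneg_left (add_le_add_right ?_ _) hden.le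
    calc K / (n : ℝ) ^ 2 = K * (1 / (n : ℝ) ^ 2) := by ring
      _ ≤ K * (256 * (2 * (C * R)) ^ 2 * ((k : ℝ) + 1) ^ 4 / len D (k + 1) ^ 2) := by gcongr
      _ = _ := by ring

theorem pow_div_isLittleO_rpow_div {ε : ℝ} (hε : 0 < ε) (f : ℕ → ℝ) :
    (fun k : ℕ => (k : ℝ) ^ 4 / f k) =o[atTop] fun k : ℕ => (k : ℝ) ^ (4 + ε) / f k := by
  have h : (fun x : ℝ => x ^ (4 : ℝ)) =o[atTop] fun x : ℝ => x ^ (4 + ε) := by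
    refine (isLittleO_iff_tendsto' ?_).mpr ((tendsto_rpow_neg_atTop hε).congr' ?_)
    · filter_upwards [eventually_gt_atTop 0] with x hx h0
      exact absurd h0 (Real.rpow_pos_of_pos hx _).ne'
    · filter_upwards [eventually_gt_atTop 0] with x hx
      rw [← Real.rpow_sub hx]
      congr 1
      ring
  have h' := (h.comp_tendsto tendsto_natCast_atTop_atTop).mul_isBigO
    (isBigO_refl (fun k : ℕ => (f k)⁻¹) atTop)
  refine h'.congr (fun k => ?_) fun k => ?_
  · simp only [Function.comp_apply, div_eq_mul_inv]
    norm_cast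
  · simp only [Function.comp_apply, div_eq_mul_inv]

end Scaling

end FFGap

theorem theorem1 {V : Type*} [DecidableEq V] (G : SimpleGraph V)
    (D : ℕ) (hD : 1 ≤ D) (C : ℝ) (hC : 1 ≤ C) (ι : V → EuclideanSpace ℝ (Fin D))
    (hι : FFGap.IsBiLipschitzEmbedding G C ι)
    (d : ℕ) (Φ : FFGap.Interaction V d)
    (R : ℝ) (hR : 0 < R) (hrange : FFGap.HasRange G Φ R)
    (hpos : ∀ X : Finset V, (Φ X).PosSemidef)
    (hmax : FFGap.phiMax Φ < ⊤) (hmin : 0 < FFGap.phiMin Φ)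
    (hFF : FFGap.FrustrationFree Φ)
    (hgap : FFGap.gapInfinite Φ ι = 0) :
    ∀ ε : ℝ, 0 < ε →
      (∀ᶠ k : ℕ in atTop, FFGap.gapFamily Φ ι k ≠ ⊤ ∧ FFGap.gapFamily Φ ι k ≠ ⊥) ∧
      (fun k : ℕ => (FFGap.gapFamily Φ ι k).toReal) =o[atTop]
        (fun k : ℕ => (k : ℝ) ^ (4 + ε) / FFGap.len D k ^ 2) := by
  have hfin : ∀ᶠ k : ℕ in atTop, FFGap.gapFamily Φ ι k ≠ ⊤ ∧ FFGap.gapFamily Φ ι k ≠ ⊥ := by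
    -- If every gap were `⊤`, so would be their infimum; one finite value persists because the gaps
    -- decrease in `k`.
    obtain ⟨k₁, hk₁⟩ : ∃ k, FFGap.gapFamily Φ ι k ≠ ⊤ := by
      by_contra hno
      push Not at hno
      simp [FFGap.gapInfinite, hno] at hgap
    filter_upwards [eventually_ge_atTop k₁] with k hk
    exact ⟨((FFGap.gapFamily_anti Φ ι hk).trans_lt (lt_top_iff_ne_top.mpr hk₁)).ne,
      (EReal.bot_lt_zero.trans_le (FFGap.gapFamily_nonneg hpos k)).ne'⟩
  obtain ⟨B, hB⟩ := FFGap.exists_gapFamily_bound hD hι hC hR hrange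
    (FFGap.apply_empty_eq_zero hFF) hpos hmax hgap hfin
  refine fun ε hε => ⟨hfin, IsBigO.trans_isLittleO ?_
    (FFGap.pow_div_isLittleO_rpow_div hε fun k => FFGap.len D k ^ 2)⟩
  refine IsBigO.of_bound B ?_
  filter_upwards [hB] with k hk
  rwa [Real.norm_of_nonneg (EReal.toReal_nonneg (FFGap.gapFamily_nonneg hpos k)),
    Real.norm_of_nonneg (by positivity)]
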